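/- For $n\in\mathbb{N}$ and $p\in[0,1]$ let $[n]_p$ be the random subset of $[n]=\{1,\dots,n\}$ that contains each element with probability $p$, independently of the others. For $\ell\ge 3$ let $X_\ell=X_\ell(n)$ be the number of arithmetic progressions $\{a,a+b,\dots,a+(\ell-1)b\}\subseteq[n]$ with common difference $b\ge 1$ that are contained in $[n]_p$, and let $\sigma_\ell:=\sqrt{\mathrm{Var}(X_\ell)}$. Let either $\ell\ge 3$ be a constant, or $\ell=\ell(n)$ be a sequence of integers with $\ell\to\infty$ and $\ell/\log n\to 0$ as $n\to\infty$; and let $p=p(n)\in(0,1]$ with $p\to 0$ as $n\to\infty$. Then, as $n\to\infty$: (a) if $n^2p^{\ell}/(\ell-1)\to c$ for some real $c\ge 0$, then $X_\ell$ converges in distribution to the Poisson distribution $\mathrm{Po}(c/2)$ with mean $c/2$ (where $\mathrm{Po}(0)$ is the point mass at $0$); (b) if $n^2p^{\ell}/(\ell-1)\to+\infty$, then $(X_\ell-\mathbb{E}(X_\ell))/\sigma_\ell$ converges in distribution to the standard normal distribution $\mathrm{N}(0,1)$. -/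

import Mathlib

noncomputable section

namespace RandomAP

/-- `T` is (the set of terms of) an arithmetic progression `a, a + b, …, a + (ℓ - 1) b` of length
`ℓ` with common difference `b ≥ 1`. -/
def IsAP (ℓ : ℕ) (T : Finset ℕ) : Prop :=
  ∃ a b : ℕ, 0 < b ∧ T = (Finset.range ℓ).image (fun i => a + i * b)

open Classical in
/-- The set of all `ℓ`-APs contained in `[n] = {1, …, n}`. -/
def apSet (ℓ n : ℕ) : Finset (Finset ℕ) :=
  {T ∈ (Finset.Icc 1 n).powerset | IsAP ℓ T}

open Classical in
/-- The number of `ℓ`-APs in `[n]` all of whose terms lie in `S`. -/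
def numAP (ℓ n : ℕ) (S : Set ℕ) : ℕ :=
  ∑ T ∈ apSet ℓ n, if (T : Set ℕ) ⊆ S then 1 else 0

/-- The law of the binomial random subset `[n]_p`: each element of `{1, …, n}` is included with
probability `p`, independently of one another, and no other number is included. -/
abbrev randomSubset (n : ℕ) (p : unitInterval) : MeasureTheory.Measure (Set ℕ) :=
  ProbabilityTheory.setBernoulli (Set.Icc 1 n) p

end RandomAP

end

open MeasureTheory ProbabilityTheory Filter Topology

/-! The indicators of the progressions lying in the random set form a locally dependent family: each
is independent of the indicators of all progressions disjoint from it. Both limits come from Stein's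
method carried out on characteristic functions. The derivative of `φ u = E exp (iuW)` is a sum of
terms `i E [ξ exp (iuW)]`. Deleting from `W` the summands whose sets meet that of `ξ` decouples the
two factors, and the deletion costs only joint moments of neighbours. Hence `φ` almost satisfies `φ'
= i μ exp (iu) φ` (Poisson) or `φ' = -u φ` (normal), and an integrating factor yields the explicit
bounds `norm_integral_cexp_sub_poisson_le` and `norm_integral_cexp_sub_gaussian_le`.

Write `μ = E X` and `D = 2 ℓ n p ^ (ℓ - 1)`; `D` bounds the weight of the progressions meeting a
given one exactly once. Those meeting it at least twice have weight bounded uniformly in `ℓ`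
(`exists_isSparse_apSet`): with the same difference they are shifts, giving a geometric series; with
another difference they share at most about half of their terms, and there are at most `ℓ ^ 4` of
them.

The Poisson error is a bounded multiple of `μ (2 D + p K)`, and `D → 0` when `c > 0`. For `c = 0`
the first moment suffices. The normal error is a multiple of `tripleSum / σ ^ 3`, where `tripleSum ≤
μ (D + C) ^ 2` (`IsSparse.tripleSum_le`). Two lower bounds on the variance finish the argument: the
diagonal bound `σ ^ 2 ≥ μ / 2` handles `μ / σ ^ 3`, and `σ ^ 2 ≥ n ^ 3 p ^ (2 ℓ - 1) / 32`, from
Cauchy-Schwarz on point degrees, handles `μ D ^ 2 / σ ^ 3`, whose square is `O(ℓ ^ 2 / (n p))`. The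
last quantity vanishes because `(n p) ^ 3 ≥ n (n ^ 2 p ^ ℓ)` and `ℓ = o(log n)`. Constant `ℓ` needs
no separate treatment. -/

namespace RandomAP

/-! ### Taylor estimates and differentiation of characteristic functions -/

section CharacteristicFunctions

open Complex

lemma norm_cexp_sub_one_le (x : ℝ) : ‖cexp (x * I) - 1‖ ≤ |x| := by
  have := Real.norm_exp_I_mul_ofReal_sub_one_le (x := x)
  rwa [mul_comm, Real.norm_eq_abs] at this

lemma hasDerivAt_cexp_mul_I (c x : ℝ) :
    HasDerivAt (fun y : ℝ => cexp ((y * c : ℝ) * I)) (c * I * cexp ((x * c : ℝ) * I)) x := by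
  have h1 : HasDerivAt (fun y : ℝ => ((y * c : ℝ) : ℂ) * I) (c * I) x := by
    have := (((hasDerivAt_id x).mul_const c).ofReal_comp).mul_const I
    simpa using this
  have := h1.cexp
  rwa [mul_comm] at this

/-- Mean value inequality: the derivative `I * (exp (iy) - 1)` is at most `|x|` between `0` and `x`.
The sharp constant `1 / 2` is not needed. -/
lemma norm_cexp_sub_one_sub_le (x : ℝ) : ‖cexp (x * I) - 1 - x * I‖ ≤ x ^ 2 := by
  have hd : ∀ y : ℝ, HasDerivAt (fun y : ℝ => cexp (y * I) - 1 - y * I)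
      (I * (cexp (y * I) - 1)) y := by
    intro y
    have h1 := hasDerivAt_cexp_mul_I 1 y
    simp only [mul_one, ofReal_one, one_mul] at h1
    have h2 : HasDerivAt (fun y : ℝ => (y : ℂ) * I) I y := by
      simpa using (hasDerivAt_id y).ofReal_comp.mul_const I
    exact ((h1.sub_const 1).sub h2).congr_deriv (by ring)
  have := (convex_uIcc (0 : ℝ) x).norm_image_sub_le_of_norm_hasDerivWithin_le (C := |x|)
    (fun y _ => (hd y).hasDerivWithinAt) (fun y hy => ?_) Set.left_mem_uIcc Set.right_mem_uIcc
  · simpa [← sq_abs x, sq] using this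
  · rw [norm_mul, norm_I, one_mul]
    refine (norm_cexp_sub_one_le y).trans ?_
    simpa using Set.abs_sub_left_of_mem_uIcc hy

/-- If `φ` almost satisfies the linear equation `φ' = g' φ`, then `φ` is close to `exp g`. -/
lemma norm_mul_exp_neg_sub_one_le {φ φ' g g' : ℝ → ℂ} (hφ : ∀ s, HasDerivAt φ (φ' s) s)
    (hg : ∀ s, HasDerivAt g (g' s) s) (hφ0 : φ 0 = 1) (hg0 : g 0 = 0) {t K : ℝ}
    (h : ∀ s ∈ Set.uIcc 0 t, ‖φ' s - g' s * φ s‖ * ‖cexp (-g s)‖ ≤ K) :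
    ‖φ t * cexp (-g t) - 1‖ ≤ K * |t| := by
  -- Integrating factor: after multiplication by `exp (-g)` only the defect of the equation survives
  -- in the derivative.
  have hd : ∀ s, HasDerivAt (fun s => φ s * cexp (-g s)) ((φ' s - g' s * φ s) * cexp (-g s)) s := by
    intro s
    exact ((hφ s).mul (hg s).neg.cexp).congr_deriv (by simp only [Pi.neg_apply]; ring)
  have := (convex_uIcc (0 : ℝ) t).norm_image_sub_le_of_norm_hasDerivWithin_le
    (fun y _ => (hd y).hasDerivWithinAt) (fun y hy => (norm_mul _ _).trans_le (h y hy))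
    Set.left_mem_uIcc Set.right_mem_uIcc
  simpa [hφ0, hg0] using this

variable {Ω : Type*} [MeasurableSpace Ω] {P : Measure Ω}

/-- The assumption `hI` that every function is integrable holds for laws carried by finitely many
points, as here, and disposes of all integrability conditions. -/
lemma integrable_of_integrable_ofReal (hI : ∀ f : Ω → ℂ, Integrable f P) (f : Ω → ℝ) :
    Integrable f P := by
  simpa using (hI (fun ω => (f ω : ℂ))).re

lemma hasDerivAt_integral_cexp (hI : ∀ f : Ω → ℂ, Integrable f P) (W : Ω → ℝ) (t : ℝ) :
    HasDerivAt (fun s : ℝ => ∫ ω, cexp ((s * W ω : ℝ) * I) ∂P)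
      (∫ ω, W ω * I * cexp ((t * W ω : ℝ) * I) ∂P) t := by
  refine (hasDerivAt_integral_of_dominated_loc_of_deriv_le (bound := fun ω => |W ω|)
    (F' := fun s ω => W ω * I * cexp ((s * W ω : ℝ) * I))
    (Metric.ball_mem_nhds t one_pos) (Eventually.of_forall fun s => (hI _).1) (hI _) (hI _).1
    ?_ ?_ ?_).2
  · refine Eventually.of_forall fun ω s _ => ?_
    rw [norm_mul, norm_exp_ofReal_mul_I]
    simp
  · exact integrable_of_integrable_ofReal hI _
  · exact Eventually.of_forall fun ω s _ => hasDerivAt_cexp_mul_I _ _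

/-- The price of deleting summands from the exponent, or of restoring them. -/
lemma norm_integral_mul_cexp_sub_le (hI : ∀ f : Ω → ℂ, Integrable f P) (c U V : Ω → ℝ) (s : ℝ) :
    ‖(∫ ω, c ω * cexp ((s * U ω : ℝ) * I) ∂P) - ∫ ω, c ω * cexp ((s * V ω : ℝ) * I) ∂P‖
      ≤ |s| * ∫ ω, |c ω| * |U ω - V ω| ∂P := by
  rw [← integral_sub (hI _) (hI _), ← integral_const_mul]
  refine norm_integral_le_of_norm_le (integrable_of_integrable_ofReal hI _)
    (Eventually.of_forall fun ω => ?_)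
  have : (c ω * cexp ((s * U ω : ℝ) * I) - c ω * cexp ((s * V ω : ℝ) * I) : ℂ)
      = c ω * cexp ((s * V ω : ℝ) * I) * (cexp ((s * (U ω - V ω) : ℝ) * I) - 1) := by
    rw [mul_sub, mul_assoc (c ω : ℂ), ← Complex.exp_add, ← add_mul, ← ofReal_add, mul_one]
    congr 5
    ring
  rw [this, norm_mul, norm_mul, norm_exp_ofReal_mul_I, norm_real, Real.norm_eq_abs, mul_one]
  calc _ ≤ |c ω| * |s * (U ω - V ω)| := by gcongr; exact norm_cexp_sub_one_le _
    _ = _ := by rw [abs_mul]; ring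

/-- The expansion is around `U`, the full sum in the application, so that the linear term carries
the same exponential as the characteristic function. -/
lemma norm_integral_mul_cexp_sub_sub_le (hI : ∀ f : Ω → ℂ, Integrable f P) (c U V : Ω → ℝ)
    (s : ℝ) :
    ‖(∫ ω, c ω * cexp ((s * U ω : ℝ) * I) ∂P) - (∫ ω, c ω * cexp ((s * V ω : ℝ) * I) ∂P)
        - s * I * ∫ ω, (c ω * (U ω - V ω) : ℝ) * cexp ((s * U ω : ℝ) * I) ∂P‖
      ≤ s ^ 2 * ∫ ω, |c ω| * (U ω - V ω) ^ 2 ∂P := by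
  rw [← integral_sub (hI _) (hI _), ← integral_const_mul, ← integral_const_mul,
    ← integral_sub (hI _) (hI _)]
  refine norm_integral_le_of_norm_le (integrable_of_integrable_ofReal hI _)
    (Eventually.of_forall fun ω => ?_)
  have : (c ω * cexp ((s * U ω : ℝ) * I) - c ω * cexp ((s * V ω : ℝ) * I)
        - s * I * ((c ω * (U ω - V ω) : ℝ) * cexp ((s * U ω : ℝ) * I)) : ℂ)
      = - (c ω * cexp ((s * U ω : ℝ) * I) * (cexp ((-(s * (U ω - V ω)) : ℝ) * I) - 1
          - (-(s * (U ω - V ω)) : ℝ) * I)) := by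
    have h : cexp ((s * V ω : ℝ) * I)
        = cexp ((s * U ω : ℝ) * I) * cexp ((-(s * (U ω - V ω)) : ℝ) * I) := by
      rw [← Complex.exp_add, ← add_mul, ← ofReal_add]
      congr 3
      ring
    rw [h]
    push_cast
    ring
  rw [this, norm_neg, norm_mul, norm_mul, norm_exp_ofReal_mul_I, norm_real, Real.norm_eq_abs,
    mul_one]
  calc _ ≤ |c ω| * (-(s * (U ω - V ω))) ^ 2 := by
        gcongr; exact norm_cexp_sub_one_sub_le _
    _ = _ := by ring

end CharacteristicFunctions

/-! ### Stein's method for locally dependent sums -/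

section LocalDependence

open Complex

variable {Ω : Type*} [MeasurableSpace Ω] {P : Measure Ω} {ι : Type*}

lemma sum_sub_sum_sdiff [DecidableEq ι] {M : Type*} [AddCommGroup M] {s t : Finset ι} (h : t ⊆ s)
    (f : ι → M) :
    ∑ j ∈ s, f j - ∑ j ∈ s \ t, f j = ∑ j ∈ t, f j := by
  rw [← Finset.sum_sdiff h]; abel

lemma hasDerivAt_integral_cexp_sum (hI : ∀ f : Ω → ℂ, Integrable f P) (s : Finset ι)
    (ξ : ι → Ω → ℝ) (t : ℝ) :
    HasDerivAt (fun u : ℝ => ∫ ω, cexp ((u * ∑ i ∈ s, ξ i ω : ℝ) * I) ∂P)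
      (I * ∑ i ∈ s, ∫ ω, ξ i ω * cexp ((t * ∑ i ∈ s, ξ i ω : ℝ) * I) ∂P) t := by
  refine (hasDerivAt_integral_cexp hI (fun ω => ∑ i ∈ s, ξ i ω) t).congr_deriv ?_
  rw [← integral_finsetSum _ (fun _ _ => hI _), ← integral_const_mul]
  congr 1 with ω
  rw [← Finset.sum_mul]
  push_cast
  ring

variable [IsProbabilityMeasure P] [DecidableEq ι]

/-- Poisson approximation of the characteristic function of a sum of locally dependent
indicators. -/
theorem norm_integral_cexp_sub_poisson_le (hI : ∀ f : Ω → ℂ, Integrable f P) (s : Finset ι)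
    (N : ι → Finset ι) (hN : ∀ i ∈ s, N i ⊆ s) (hself : ∀ i ∈ s, i ∈ N i) (J : ι → Ω → ℝ)
    (hJ : ∀ i ω, J i ω = 0 ∨ J i ω = 1)
    (hind : ∀ i ∈ s, ∀ t : ℝ, ∫ ω, J i ω * cexp ((t * ∑ j ∈ s \ N i, J j ω : ℝ) * I) ∂P
      = (∫ ω, J i ω ∂P : ℝ) * ∫ ω, cexp ((t * ∑ j ∈ s \ N i, J j ω : ℝ) * I) ∂P) (t : ℝ) :
    ‖(∫ ω, cexp ((t * ∑ i ∈ s, J i ω : ℝ) * I) ∂P)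
        - cexp ((∑ i ∈ s, ∫ ω, J i ω ∂P : ℝ) * (cexp (t * I) - 1))‖
      ≤ t ^ 2 * Real.exp (2 * ∑ i ∈ s, ∫ ω, J i ω ∂P)
        * (∑ i ∈ s, ∑ j ∈ (N i).erase i, ∫ ω, J i ω * J j ω ∂P
          + ∑ i ∈ s, ∑ j ∈ N i, (∫ ω, J i ω ∂P) * ∫ ω, J j ω ∂P) := by
  have hR := integrable_of_integrable_ofReal hI
  have hJ0 : ∀ i ω, 0 ≤ J i ω := fun i ω => by rcases hJ i ω with h | h <;> simp [h]
  set X : Ω → ℝ := fun ω => ∑ i ∈ s, J i ω with hX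
  set m : ι → ℝ := fun i => ∫ ω, J i ω ∂P with hm
  have hm0 : ∀ i, 0 ≤ m i := fun i => integral_nonneg (hJ0 i)
  set μ : ℝ := ∑ i ∈ s, m i with hμ
  have hμ0 : 0 ≤ μ := Finset.sum_nonneg fun i _ => hm0 i
  set φ : ℝ → ℂ := fun u => ∫ ω, cexp ((u * X ω : ℝ) * I) ∂P with hφ
  set δ : ι → ℝ := fun i => ∑ j ∈ (N i).erase i, ∫ ω, J i ω * J j ω ∂P
    + ∑ j ∈ N i, m i * m j with hδ
  have hδ0 : ∀ i, 0 ≤ δ i := fun i => add_nonneg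
    (Finset.sum_nonneg fun j _ => integral_nonneg fun ω => mul_nonneg (hJ0 i ω) (hJ0 j ω))
    (Finset.sum_nonneg fun j _ => mul_nonneg (hm0 i) (hm0 j))
  -- Where `J i = 1`, the sum `X` is close to `V + 1`, with `V` the sum outside the neighbourhood;
  -- the `1` is `J i` itself and produces the factor `exp (iu)`. After decoupling, `V` is turned
  -- back into `X`.
  have key : ∀ i ∈ s, ∀ u : ℝ,
      ‖(∫ ω, J i ω * cexp ((u * X ω : ℝ) * I) ∂P) - m i * cexp (u * I) * φ u‖ ≤ |u| * δ i := by
    intro i hi u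
    set V : Ω → ℝ := fun ω => ∑ j ∈ s \ N i, J j ω with hV
    have hXV : ∀ ω, X ω - V ω = ∑ j ∈ N i, J j ω := fun ω => sum_sub_sum_sdiff (hN i hi) _
    have h1 := norm_integral_mul_cexp_sub_le hI (J i) X (fun ω => V ω + 1) u
    have h1' : ∫ ω, |J i ω| * |X ω - (V ω + 1)| ∂P
        = ∑ j ∈ (N i).erase i, ∫ ω, J i ω * J j ω ∂P := by
      rw [← integral_finsetSum _ (fun _ _ => hR _)]
      congr 1 with ω
      rw [← Finset.mul_sum]
      rcases hJ i ω with h | h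
      · simp [h]
      · have : X ω - (V ω + 1) = ∑ j ∈ (N i).erase i, J j ω := by
          have := Finset.add_sum_erase (N i) (fun j => J j ω) (hself i hi)
          simp only [h] at this
          linarith [hXV ω]
        rw [this, h, abs_one, abs_of_nonneg (Finset.sum_nonneg fun j _ => hJ0 j ω)]
    have h2 : ∫ ω, J i ω * cexp ((u * (V ω + 1) : ℝ) * I) ∂P
        = m i * cexp (u * I) * ∫ ω, cexp ((u * V ω : ℝ) * I) ∂P := by
      calc _ = ∫ ω, cexp (u * I) * (J i ω * cexp ((u * V ω : ℝ) * I)) ∂P := by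
            congr 1 with ω
            have : cexp ((u * (V ω + 1) : ℝ) * I) = cexp (u * I) * cexp ((u * V ω : ℝ) * I) := by
              rw [← Complex.exp_add]
              congr 1
              push_cast
              ring
            rw [this]
            ring
        _ = _ := by
            rw [integral_const_mul, hind i hi u]
            ring
    have h3 := norm_integral_mul_cexp_sub_le hI (fun _ => 1) X V u
    simp only [ofReal_one, one_mul, abs_one] at h3
    have h3' : ∫ ω, |X ω - V ω| ∂P = ∑ j ∈ N i, m j := by
      rw [← integral_finsetSum _ (fun _ _ => hR _)]
      congr 1 with ω
      rw [hXV, abs_of_nonneg (Finset.sum_nonneg fun j _ => hJ0 j ω)]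
    rw [h1', h2] at h1
    rw [h3', norm_sub_rev] at h3
    have h4 : ‖(m i * cexp (u * I) : ℂ)‖ = m i := by
      rw [norm_mul, norm_exp_ofReal_mul_I, norm_real, Real.norm_eq_abs, abs_of_nonneg (hm0 i),
        mul_one]
    calc _ ≤ _ := norm_sub_le_norm_sub_add_norm_sub _
            (m i * cexp (u * I) * ∫ ω, cexp ((u * V ω : ℝ) * I) ∂P) _
      _ ≤ |u| * (∑ j ∈ (N i).erase i, ∫ ω, J i ω * J j ω ∂P) + m i * (|u| * ∑ j ∈ N i, m j) := by
          refine add_le_add h1 ?_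
          rw [← mul_sub, norm_mul, h4]
          exact mul_le_mul_of_nonneg_left h3 (hm0 i)
      _ = |u| * δ i := by
          rw [hδ]
          simp only [← Finset.mul_sum]
          ring
  have hg : ∀ u : ℝ, HasDerivAt (fun u : ℝ => (μ : ℂ) * (cexp (u * I) - 1))
      (μ * (I * cexp (u * I))) u := by
    intro u
    have h1 := hasDerivAt_cexp_mul_I 1 u
    simp only [mul_one, ofReal_one, one_mul] at h1
    exact (h1.sub_const 1).const_mul _
  have hre : ∀ u : ℝ, ((μ : ℂ) * (cexp (u * I) - 1)).re = μ * (Real.cos u - 1) := by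
    intro u
    rw [re_ofReal_mul, sub_re, exp_ofReal_mul_I_re, one_re]
  have main := norm_mul_exp_neg_sub_one_le (φ := φ) (t := t)
    (K := |t| * (∑ i ∈ s, δ i) * Real.exp (2 * μ))
    (fun u => hasDerivAt_integral_cexp_sum hI s J u) hg (by simp [hφ]) (by simp) (fun u hu => ?_)
  · have hexp : ∀ z w : ℂ, z - cexp w = cexp w * (z * cexp (-w) - 1) := by
      intro z w
      rw [mul_sub, mul_left_comm, ← Complex.exp_add]
      simp
    rw [hexp, norm_mul, norm_exp, hre]
    have h1 : Real.exp (μ * (Real.cos t - 1)) ≤ 1 := by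
      rw [Real.exp_le_one_iff]
      nlinarith [Real.cos_le_one t]
    calc _ ≤ 1 * (|t| * (∑ i ∈ s, δ i) * Real.exp (2 * μ) * |t|) := by gcongr
      _ = |t| ^ 2 * Real.exp (2 * μ) * ∑ i ∈ s, δ i := by ring
      _ = _ := by rw [sq_abs, Finset.sum_add_distrib]
  · have hu' : |u| ≤ |t| := by simpa using Set.abs_sub_left_of_mem_uIcc hu
    rw [norm_exp, neg_re, hre]
    refine mul_le_mul ?_ (Real.exp_le_exp.2 ?_) (Real.exp_nonneg _) ?_
    · have : I * ∑ i ∈ s, (∫ ω, J i ω * cexp ((u * X ω : ℝ) * I) ∂P)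
            - μ * (I * cexp (u * I)) * φ u
          = I * ∑ i ∈ s, ((∫ ω, J i ω * cexp ((u * X ω : ℝ) * I) ∂P)
            - m i * cexp (u * I) * φ u) := by
        rw [Finset.sum_sub_distrib, ← Finset.sum_mul, ← Finset.sum_mul, hμ]
        push_cast
        ring
      rw [this, norm_mul, norm_I, one_mul, Finset.mul_sum]
      refine (norm_sum_le_of_le _ fun i hi => key i hi u).trans ?_
      exact Finset.sum_le_sum fun i _ => mul_le_mul_of_nonneg_right hu' (hδ0 i)
    -- `Re (-g u) = μ (1 - cos u) ≤ 2 μ`, the source of the factor `exp (2 μ)`.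
    · nlinarith [Real.neg_one_le_cos u]
    · exact mul_nonneg (abs_nonneg _) (Finset.sum_nonneg fun i _ => hδ0 i)

/-- Normal approximation of the characteristic function of a sum of locally dependent centred
random variables of total variance `1`. -/
theorem norm_integral_cexp_sub_gaussian_le (hI : ∀ f : Ω → ℂ, Integrable f P) (s : Finset ι)
    (N : ι → Finset ι) (hN : ∀ i ∈ s, N i ⊆ s) (ξ : ι → Ω → ℝ)
    (hind : ∀ i ∈ s, ∀ t : ℝ, ∫ ω, ξ i ω * cexp ((t * ∑ j ∈ s \ N i, ξ j ω : ℝ) * I) ∂P = 0)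
    (hind₂ : ∀ i ∈ s, ∀ j ∈ N i, ∀ t : ℝ,
      ∫ ω, (ξ i ω * ξ j ω : ℝ) * cexp ((t * ∑ k ∈ s \ (N i ∪ N j), ξ k ω : ℝ) * I) ∂P
      = (∫ ω, ξ i ω * ξ j ω ∂P : ℝ)
        * ∫ ω, cexp ((t * ∑ k ∈ s \ (N i ∪ N j), ξ k ω : ℝ) * I) ∂P)
    (hvar : ∑ i ∈ s, ∑ j ∈ N i, ∫ ω, ξ i ω * ξ j ω ∂P = 1) (t : ℝ) :
    ‖(∫ ω, cexp ((t * ∑ i ∈ s, ξ i ω : ℝ) * I) ∂P) - cexp (-(t ^ 2 / 2 : ℝ))‖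
      ≤ 2 * |t| ^ 3 * ∑ i ∈ s, ∑ j ∈ N i, ∑ k ∈ N i ∪ N j,
        (∫ ω, |ξ i ω| * |ξ j ω| * |ξ k ω| ∂P
          + (∫ ω, |ξ i ω| * |ξ j ω| ∂P) * ∫ ω, |ξ k ω| ∂P) := by
  have hR := integrable_of_integrable_ofReal hI
  set W : Ω → ℝ := fun ω => ∑ i ∈ s, ξ i ω with hW
  set φ : ℝ → ℂ := fun u => ∫ ω, cexp ((u * W ω : ℝ) * I) ∂P with hφ
  set c : ι → ι → ℝ := fun i j => ∫ ω, ξ i ω * ξ j ω ∂P with hc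
  set B : ι → ι → ℝ → ℂ := fun i j u => ∫ ω, (ξ i ω * ξ j ω : ℝ) * cexp ((u * W ω : ℝ) * I) ∂P
    with hB
  set ε₁ : ι → ι → ι → ℝ := fun i j k => ∫ ω, |ξ i ω| * |ξ j ω| * |ξ k ω| ∂P with hε₁
  set ε₂ : ι → ι → ι → ℝ := fun i j k => (∫ ω, |ξ i ω| * |ξ j ω| ∂P) * ∫ ω, |ξ k ω| ∂P with hε₂
  have hε₁0 : ∀ i j k, 0 ≤ ε₁ i j k := fun i j k => integral_nonneg fun ω => by positivity
  have hε₂0 : ∀ i j k, 0 ≤ ε₂ i j k := fun i j k =>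
    mul_nonneg (integral_nonneg fun ω => by positivity) (integral_nonneg fun ω => by positivity)
  set ε : ℝ := ∑ i ∈ s, ∑ j ∈ N i, ∑ k ∈ N i ∪ N j, (ε₁ i j k + ε₂ i j k) with hε
  -- First deletion, to second order: the constant term vanishes by `hind`, so the linear term in
  -- the neighbours of `i` is the main one.
  have key₁ : ∀ i ∈ s, ∀ u : ℝ,
      ‖(∫ ω, ξ i ω * cexp ((u * W ω : ℝ) * I) ∂P) - u * I * ∑ j ∈ N i, B i j u‖
        ≤ u ^ 2 * ∑ j ∈ N i, ∑ k ∈ N i ∪ N j, (ε₁ i j k + ε₂ i j k) := by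
    intro i hi u
    set V : Ω → ℝ := fun ω => ∑ j ∈ s \ N i, ξ j ω with hV
    have hWV : ∀ ω, W ω - V ω = ∑ j ∈ N i, ξ j ω := fun ω => sum_sub_sum_sdiff (hN i hi) _
    have h1 := norm_integral_mul_cexp_sub_sub_le hI (ξ i) W V u
    rw [hind i hi u, sub_zero] at h1
    have h2 : ∫ ω, (ξ i ω * (W ω - V ω) : ℝ) * cexp ((u * W ω : ℝ) * I) ∂P
        = ∑ j ∈ N i, B i j u := by
      rw [← integral_finsetSum _ (fun _ _ => hI _)]
      congr 1 with ω
      rw [hWV, Finset.mul_sum, ← Finset.sum_mul]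
      push_cast
      rfl
    rw [h2] at h1
    refine h1.trans (mul_le_mul_of_nonneg_left ?_ (sq_nonneg u))
    calc ∫ ω, |ξ i ω| * (W ω - V ω) ^ 2 ∂P
        ≤ ∫ ω, ∑ j ∈ N i, ∑ k ∈ N i, |ξ i ω| * |ξ j ω| * |ξ k ω| ∂P := by
          refine integral_mono (hR _) (hR _) fun ω => ?_
          simp only [hWV]
          calc |ξ i ω| * (∑ j ∈ N i, ξ j ω) ^ 2 ≤ |ξ i ω| * (∑ j ∈ N i, |ξ j ω|) ^ 2 := by
                rw [← sq_abs]
                gcongr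
                exact Finset.abs_sum_le_sum_abs _ _
            _ = _ := by
                rw [sq, Finset.sum_mul_sum, Finset.mul_sum]
                simp only [Finset.mul_sum, mul_assoc]
      _ = ∑ j ∈ N i, ∑ k ∈ N i, ε₁ i j k := by
          rw [integral_finsetSum _ (fun _ _ => hR _)]
          exact Finset.sum_congr rfl fun j _ => integral_finsetSum _ (fun _ _ => hR _)
      _ ≤ _ := Finset.sum_le_sum fun j _ =>
          (Finset.sum_le_sum fun k _ => le_add_of_nonneg_right (hε₂0 i j k)).trans
          (Finset.sum_le_sum_of_subset_of_nonneg Finset.subset_union_left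
            fun k _ _ => add_nonneg (hε₁0 i j k) (hε₂0 i j k))
  -- Second deletion: without the neighbours of both `i` and `j` the product `ξ i * ξ j` decouples;
  -- they are then restored to recover `φ`.
  have key₂ : ∀ i ∈ s, ∀ j ∈ N i, ∀ u : ℝ,
      ‖B i j u - c i j * φ u‖ ≤ |u| * ∑ k ∈ N i ∪ N j, (ε₁ i j k + ε₂ i j k) := by
    intro i hi j hj u
    set V : Ω → ℝ := fun ω => ∑ k ∈ s \ (N i ∪ N j), ξ k ω with hV
    have hWV : ∀ ω, W ω - V ω = ∑ k ∈ N i ∪ N j, ξ k ω := fun ω =>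
      sum_sub_sum_sdiff (Finset.union_subset (hN i hi) (hN j (hN i hi hj))) _
    have h1 := norm_integral_mul_cexp_sub_le hI (fun ω => ξ i ω * ξ j ω) W V u
    rw [hind₂ i hi j hj u] at h1
    have h3 := norm_integral_mul_cexp_sub_le hI (fun _ => 1) W V u
    simp only [ofReal_one, one_mul, abs_one] at h3
    rw [norm_sub_rev] at h3
    have hc' : ‖(c i j : ℂ)‖ ≤ ∫ ω, |ξ i ω| * |ξ j ω| ∂P := by
      rw [norm_real]
      refine (norm_integral_le_integral_norm _).trans_eq ?_
      simp only [Real.norm_eq_abs, abs_mul]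
    have h4 : ∫ ω, |ξ i ω * ξ j ω| * |W ω - V ω| ∂P ≤ ∑ k ∈ N i ∪ N j, ε₁ i j k := by
      rw [← integral_finsetSum _ (fun _ _ => hR _)]
      refine integral_mono (hR _) (hR _) fun ω => ?_
      simp only [hWV, abs_mul, ← Finset.mul_sum]
      gcongr
      exact Finset.abs_sum_le_sum_abs _ _
    have h5 : ∫ ω, |W ω - V ω| ∂P ≤ ∑ k ∈ N i ∪ N j, ∫ ω, |ξ k ω| ∂P := by
      rw [← integral_finsetSum _ (fun _ _ => hR _)]
      refine integral_mono (hR _) (hR _) fun ω => ?_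
      simp only [hWV]
      exact Finset.abs_sum_le_sum_abs _ _
    calc _ ≤ _ := norm_sub_le_norm_sub_add_norm_sub _
            (c i j * ∫ ω, cexp ((u * V ω : ℝ) * I) ∂P) _
      _ ≤ |u| * (∑ k ∈ N i ∪ N j, ε₁ i j k)
          + (∫ ω, |ξ i ω| * |ξ j ω| ∂P) * (|u| * ∑ k ∈ N i ∪ N j, ∫ ω, |ξ k ω| ∂P) := by
          refine add_le_add (h1.trans (by gcongr)) ?_
          rw [← mul_sub, norm_mul]
          exact mul_le_mul hc' (h3.trans (by gcongr)) (norm_nonneg _)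
            (integral_nonneg fun ω => by positivity)
      _ = _ := by
          rw [Finset.sum_add_distrib, hε₂, ← Finset.mul_sum]
          ring
  have hg : ∀ u : ℝ, HasDerivAt (fun u : ℝ => ((-(u ^ 2 / 2) : ℝ) : ℂ)) (((-u : ℝ) : ℂ)) u := by
    intro u
    refine HasDerivAt.ofReal_comp ?_
    exact (((hasDerivAt_id u).pow 2).div_const 2).neg.congr_deriv (by simp)
  have hε0 : 0 ≤ ε := Finset.sum_nonneg fun i _ => Finset.sum_nonneg fun j _ =>
    Finset.sum_nonneg fun k _ => add_nonneg (hε₁0 i j k) (hε₂0 i j k)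
  have main := norm_mul_exp_neg_sub_one_le (φ := φ) (t := t)
    (K := 2 * t ^ 2 * ε * Real.exp (t ^ 2 / 2))
    (fun u => hasDerivAt_integral_cexp_sum hI s ξ u) hg (by simp [hφ]) (by simp) (fun u hu => ?_)
  · have hexp : ∀ z w : ℂ, z - cexp w = cexp w * (z * cexp (-w) - 1) := by
      intro z w
      rw [mul_sub, mul_left_comm, ← Complex.exp_add]
      simp
    rw [← ofReal_neg, hexp, norm_mul, norm_exp, ofReal_re]
    calc _ ≤ Real.exp (-(t ^ 2 / 2)) * (2 * t ^ 2 * ε * Real.exp (t ^ 2 / 2) * |t|) := by gcongr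
      _ = 2 * (|t| ^ 2 * |t|) * ε * (Real.exp (-(t ^ 2 / 2)) * Real.exp (t ^ 2 / 2)) := by
          rw [sq_abs]; ring
      _ = _ := by rw [← Real.exp_add, neg_add_cancel, Real.exp_zero]; ring
  · have hu' : u ^ 2 ≤ t ^ 2 := sq_le_sq.2 (by simpa using Set.abs_sub_left_of_mem_uIcc hu)
    rw [norm_exp, neg_re, ofReal_re, neg_neg]
    refine mul_le_mul ?_ (Real.exp_le_exp.2 (by linarith)) (Real.exp_nonneg _) (by positivity)
    -- The covariances add up to `1` and `I * (u * I) = -u`, so the main terms cancel against `-u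
    -- φ`.
    have : I * ∑ i ∈ s, (∫ ω, ξ i ω * cexp ((u * W ω : ℝ) * I) ∂P) - (-u : ℝ) * φ u
        = I * ∑ i ∈ s, ((∫ ω, ξ i ω * cexp ((u * W ω : ℝ) * I) ∂P) - u * I * ∑ j ∈ N i, B i j u)
          - u * ∑ i ∈ s, ∑ j ∈ N i, (B i j u - c i j * φ u) := by
      have h1 : ∑ i ∈ s, ∑ j ∈ N i, (B i j u - c i j * φ u)
          = ∑ i ∈ s, ∑ j ∈ N i, B i j u - φ u := by
        simp only [Finset.sum_sub_distrib, ← Finset.sum_mul]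
        have : ∑ i ∈ s, ∑ j ∈ N i, (c i j : ℂ) = 1 := by exact_mod_cast hvar
        rw [this, one_mul]
      rw [h1, Finset.sum_sub_distrib, ← Finset.mul_sum, mul_sub, ← mul_assoc I, mul_left_comm I,
        I_mul_I]
      push_cast
      ring
    rw [this]
    have e1 : ‖I * ∑ i ∈ s, ((∫ ω, ξ i ω * cexp ((u * W ω : ℝ) * I) ∂P)
        - u * I * ∑ j ∈ N i, B i j u)‖ ≤ u ^ 2 * ε := by
      rw [norm_mul, norm_I, one_mul, hε, Finset.mul_sum]
      exact norm_sum_le_of_le _ fun i hi => key₁ i hi u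
    have e2 : ‖(u : ℂ) * ∑ i ∈ s, ∑ j ∈ N i, (B i j u - c i j * φ u)‖ ≤ u ^ 2 * ε := by
      rw [norm_mul, norm_real, Real.norm_eq_abs, ← sq_abs, sq, mul_assoc]
      gcongr
      rw [hε, Finset.mul_sum]
      refine norm_sum_le_of_le _ fun i hi => ?_
      rw [Finset.mul_sum]
      exact norm_sum_le_of_le _ fun j hj => key₂ i hi j hj u
    calc _ ≤ u ^ 2 * ε + u ^ 2 * ε := (norm_sub_le _ _).trans (add_le_add e1 e2)
      _ ≤ t ^ 2 * ε + t ^ 2 * ε := by gcongr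
      _ = _ := by ring

end LocalDependence

/-! ### Independence and moments for the random subset -/

section RandomSubset

variable {n : ℕ} {p : unitInterval}

/-- The law is carried by the finitely many subsets of `[n]`. -/
lemma integrable_randomSubset (f : Set ℕ → ℂ) : Integrable f (randomSubset n p) := by
  have hfin : {S : Set ℕ | S ⊆ Set.Icc 1 n}.Finite := (Set.finite_Icc 1 n).finite_subsets
  have hae : ∀ᵐ S ∂(randomSubset n p), S ∈ {S : Set ℕ | S ⊆ Set.Icc 1 n} := setBernoulli_ae_subset
  rw [← Measure.restrict_eq_self_of_ae_mem hae]
  exact IntegrableOn.of_finite hfin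

lemma integrable_randomSubset_real (f : Set ℕ → ℝ) : Integrable f (randomSubset n p) :=
  integrable_of_integrable_ofReal integrable_randomSubset f

/-- Functions of the traces of the random subset on two disjoint finite sets are uncorrelated. -/
lemma integral_randomSubset_mul {A B : Finset ℕ} (hAB : Disjoint A B) {f g : Set ℕ → ℂ}
    (hf : ∀ S, f (S ∩ A) = f S) (hg : ∀ S, g (S ∩ B) = g S) :
    ∫ S, f S * g S ∂(randomSubset n p)
      = (∫ S, f S ∂(randomSubset n p)) * ∫ S, g S ∂(randomSubset n p) := by
  have hI := integrable_randomSubset (n := n) (p := p)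
  simp only [randomSubset, setBernoulli_eq_map] at hI ⊢
  have hm : Measurable (fun q : ℕ → Prop => {i | q i}) :=
    MeasurableEquiv.setOfPred.measurable
  rw [integral_map hm.aemeasurable (hI _).1, integral_map hm.aemeasurable (hI _).1,
    integral_map hm.aemeasurable (hI _).1]
  set μ : ℕ → Measure Prop := fun i => unitInterval.toNNReal p • Measure.dirac (i ∈ Set.Icc 1 n)
    + unitInterval.toNNReal (unitInterval.symm p) • Measure.dirac False with hμ
  have hind : iIndepFun (fun i (ω : ℕ → Prop) => ω i) (Measure.infinitePi μ) :=
    iIndepFun_infinitePi (X := fun _ => id) (fun _ => measurable_id)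
  have h := hind.indepFun_finset A B hAB (fun i => measurable_pi_apply i)
  -- A function of the trace on `C` factors through the coordinates indexed by `C`, so independence
  -- of disjoint blocks of coordinates applies.
  have hext : ∀ (C : Finset ℕ) (k : Set ℕ → ℂ), (∀ S, k (S ∩ C) = k S) →
      (fun ω : ℕ → Prop => k {i | ω i})
        = (fun y : C → Prop => k {i | ∃ h : i ∈ C, y ⟨i, h⟩}) ∘ (fun ω (i : C) => ω i) := by
    intro C k hk
    funext ω
    rw [Function.comp_apply, ← hk]
    congr 1
    ext i
    simp [and_comm]
  have h2 := h.comp (φ := fun y : A → Prop => f {i | ∃ h : i ∈ A, y ⟨i, h⟩})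
    (ψ := fun y : B → Prop => g {i | ∃ h : i ∈ B, y ⟨i, h⟩})
    (measurable_of_countable _) (measurable_of_countable _)
  rw [← hext A f hf, ← hext B g hg] at h2
  exact h2.integral_fun_mul_eq_mul_integral ((hI f).comp_measurable hm).1
    ((hI g).comp_measurable hm).1

/-- The indicator of the event that the random set contains `a`. -/
noncomputable def containsInd (a : Finset ℕ) : Set ℕ → ℝ :=
  {S : Set ℕ | (a : Set ℕ) ⊆ S}.indicator 1

lemma containsInd_of_subset {a : Finset ℕ} {S : Set ℕ} (h : (a : Set ℕ) ⊆ S) :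
    containsInd a S = 1 := Set.indicator_of_mem (s := {S : Set ℕ | (a : Set ℕ) ⊆ S}) h 1

lemma containsInd_of_not_subset {a : Finset ℕ} {S : Set ℕ} (h : ¬ (a : Set ℕ) ⊆ S) :
    containsInd a S = 0 := Set.indicator_of_notMem (s := {S : Set ℕ | (a : Set ℕ) ⊆ S}) h 1

lemma containsInd_eq_zero_or_one (a : Finset ℕ) (S : Set ℕ) :
    containsInd a S = 0 ∨ containsInd a S = 1 := by
  by_cases h : (a : Set ℕ) ⊆ S
  · exact .inr (containsInd_of_subset h)
  · exact .inl (containsInd_of_not_subset h)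

lemma containsInd_nonneg (a : Finset ℕ) (S : Set ℕ) : 0 ≤ containsInd a S := by
  rcases containsInd_eq_zero_or_one a S with h | h <;> simp [h]

lemma containsInd_congr {a b : Finset ℕ} {S T : Set ℕ}
    (h : (a : Set ℕ) ⊆ S ↔ (b : Set ℕ) ⊆ T) : containsInd a S = containsInd b T := by
  by_cases h' : (a : Set ℕ) ⊆ S
  · rw [containsInd_of_subset h', containsInd_of_subset (h.1 h')]
  · rw [containsInd_of_not_subset h', containsInd_of_not_subset (mt h.2 h')]

lemma containsInd_mul (a b : Finset ℕ) (S : Set ℕ) :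
    containsInd a S * containsInd b S = containsInd (a ∪ b) S := by
  by_cases h : (a : Set ℕ) ⊆ S
  · rw [containsInd_of_subset h, one_mul]
    exact containsInd_congr (by simp [h])
  · rw [containsInd_of_not_subset h, zero_mul, containsInd_of_not_subset (by simp [h])]

lemma containsInd_inter {a A : Finset ℕ} (h : a ⊆ A) (S : Set ℕ) :
    containsInd a (S ∩ A) = containsInd a S := by
  have : (a : Set ℕ) ⊆ A := by exact_mod_cast h
  exact containsInd_congr (by simp [Set.subset_inter_iff, this])

lemma measurableSet_superset (a : Finset ℕ) : MeasurableSet {S : Set ℕ | (a : Set ℕ) ⊆ S} := by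
  have : {S : Set ℕ | (a : Set ℕ) ⊆ S} = ⋂ i ∈ a, {S : Set ℕ | i ∈ S} := by
    ext S; simp [Set.subset_def]
  rw [this]
  exact Finset.measurableSet_biInter _ fun i _ => measurableSet_mem i

lemma integral_containsInd {a : Finset ℕ} (ha : a ⊆ Finset.Icc 1 n) :
    ∫ S, containsInd a S ∂(randomSubset n p) = (p : ℝ) ^ a.card := by
  rw [containsInd, integral_indicator_one (measurableSet_superset a), measureReal_def,
    randomSubset, setBernoulli_apply']
  have h2 : (fun q : ℕ → Prop => {i | q i}) ⁻¹' {S : Set ℕ | (a : Set ℕ) ⊆ S}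
      = Set.pi a (fun _ => {True}) := by
    ext q; simp [Set.subset_def, Set.mem_pi]
  rw [h2, Measure.infinitePi_pi _ (fun _ _ => measurableSet_singleton _), Finset.prod_congr rfl
    (g := fun _ => (unitInterval.toNNReal p : ENNReal)), Finset.prod_const]
  · simp
  · intro i hi
    have := Finset.mem_Icc.1 (ha hi)
    simp [this.1, this.2]

end RandomSubset

/-! ### Uniform set families: variance and approximation bounds -/

section SetFamilies

/-- The members of the family `F` that meet `a`. -/
def meeting (F : Finset (Finset ℕ)) (a : Finset ℕ) : Finset (Finset ℕ) :=
  {b ∈ F | ¬ Disjoint a b}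

lemma meeting_subset (F : Finset (Finset ℕ)) (a : Finset ℕ) : meeting F a ⊆ F :=
  Finset.filter_subset _ _

lemma mem_meeting {F : Finset (Finset ℕ)} {a b : Finset ℕ} :
    b ∈ meeting F a ↔ b ∈ F ∧ ¬ Disjoint a b := Finset.mem_filter

/-- The weighted number of triples in `F` of which the last two members meet the first. -/
noncomputable def tripleSum (F : Finset (Finset ℕ)) (p : ℝ) : ℝ :=
  ∑ a ∈ F, ∑ b ∈ meeting F a, ∑ c ∈ meeting F a, p ^ (a ∪ b ∪ c).card

variable {n ℓ : ℕ} {p : unitInterval} {F : Finset (Finset ℕ)}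

open Complex in
-- The exponential sees only the union of `G`, which misses `A`. A free `h` covers both plain and
-- centred indicators.
lemma integral_mul_cexp_sum (A : Finset ℕ) (G : Finset (Finset ℕ)) (hG : ∀ b ∈ G, Disjoint A b)
    (u : Set ℕ → ℝ) (hu : ∀ S, u (S ∩ A) = u S) (h : ℝ → ℝ) (t : ℝ) :
    ∫ S, u S * cexp ((t * ∑ b ∈ G, h (containsInd b S) : ℝ) * I) ∂(randomSubset n p)
      = (∫ S, u S ∂(randomSubset n p) : ℝ)
        * ∫ S, cexp ((t * ∑ b ∈ G, h (containsInd b S) : ℝ) * I) ∂(randomSubset n p) := by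
  rw [← integral_complex_ofReal]
  refine integral_randomSubset_mul (A := A) (B := G.biUnion id) ?_ (fun S => by rw [hu]) fun S => ?_
  · exact (Finset.disjoint_biUnion_right _ _ _).2 hG
  · rw [Finset.sum_congr rfl fun b hb => ?_]
    rw [containsInd_inter]
    exact Finset.subset_biUnion_of_mem id hb

open Complex in
lemma norm_integral_sub_poisson_le (hn : ∀ a ∈ F, a ⊆ Finset.Icc 1 n) (hℓ : ∀ a ∈ F, a.card = ℓ)
    (hpos : 0 < ℓ) (t : ℝ) :
    ‖(∫ S, cexp ((t * ∑ a ∈ F, containsInd a S : ℝ) * I) ∂(randomSubset n p))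
        - cexp ((F.card * (p : ℝ) ^ ℓ : ℝ) * (cexp (t * I) - 1))‖
      ≤ t ^ 2 * Real.exp (2 * (F.card * (p : ℝ) ^ ℓ))
        * (∑ a ∈ F, ∑ b ∈ (meeting F a).erase a, (p : ℝ) ^ (a ∪ b).card
          + ∑ a ∈ F, ∑ _b ∈ meeting F a, (p : ℝ) ^ ℓ * (p : ℝ) ^ ℓ) := by
  have h := norm_integral_cexp_sub_poisson_le (integrable_randomSubset (n := n) (p := p)) F
    (meeting F) (fun a _ => meeting_subset F a) (fun a ha => ?_) containsInd
    containsInd_eq_zero_or_one (fun a ha t => ?_) t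
  · have h1 : ∀ a ∈ F, ∫ S, containsInd a S ∂(randomSubset n p) = (p : ℝ) ^ ℓ := fun a ha => by
      rw [integral_containsInd (hn a ha), hℓ a ha]
    rw [Finset.sum_congr rfl h1, Finset.sum_const, nsmul_eq_mul] at h
    rw [Finset.sum_congr rfl fun a ha => Finset.sum_congr rfl fun b hb => by
        have hb' := meeting_subset F a (Finset.mem_of_mem_erase hb)
        simp only [containsInd_mul]
        rw [integral_containsInd (Finset.union_subset (hn a ha) (hn b hb'))],
      Finset.sum_congr (s₁ := F) rfl fun a ha => Finset.sum_congr (s₁ := meeting F a) rfl fun b hb =>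
        by rw [h1 a ha, h1 b (meeting_subset F a hb)]] at h
    exact h
  · rw [mem_meeting, Finset.disjoint_self_iff_empty, ← Finset.card_eq_zero, hℓ a ha]
    exact ⟨ha, hpos.ne'⟩
  · refine integral_mul_cexp_sum a (F \ meeting F a) (fun b hb => ?_) (containsInd a)
      (containsInd_inter (Finset.Subset.refl a)) id t
    rw [Finset.mem_sdiff, mem_meeting] at hb
    tauto

lemma integral_centered_mul (hn : ∀ a ∈ F, a ⊆ Finset.Icc 1 n) (hℓ : ∀ a ∈ F, a.card = ℓ)
    {a b : Finset ℕ} (ha : a ∈ F) (hb : b ∈ F) :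
    ∫ S, (containsInd a S - (p : ℝ) ^ ℓ) * (containsInd b S - (p : ℝ) ^ ℓ) ∂(randomSubset n p)
      = (p : ℝ) ^ (a ∪ b).card - (p : ℝ) ^ (2 * ℓ) := by
  have hR := integrable_randomSubset_real (n := n) (p := p)
  have : ∀ S, (containsInd a S - (p : ℝ) ^ ℓ) * (containsInd b S - (p : ℝ) ^ ℓ)
      = containsInd (a ∪ b) S - (p : ℝ) ^ ℓ * containsInd a S - (p : ℝ) ^ ℓ * containsInd b S
        + (p : ℝ) ^ ℓ * (p : ℝ) ^ ℓ := by
    intro S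
    rw [← containsInd_mul]
    ring
  simp only [this]
  rw [integral_add (hR _) (hR _), integral_sub (hR _) (hR _), integral_sub (hR _) (hR _),
    integral_const_mul, integral_const_mul, integral_containsInd (hn a ha),
    integral_containsInd (hn b hb), integral_containsInd (Finset.union_subset (hn a ha) (hn b hb)),
    hℓ a ha, hℓ b hb]
  simp
  ring

lemma integral_sum_containsInd (hn : ∀ a ∈ F, a ⊆ Finset.Icc 1 n) (hℓ : ∀ a ∈ F, a.card = ℓ) :
    ∫ S, ∑ a ∈ F, containsInd a S ∂(randomSubset n p) = F.card * (p : ℝ) ^ ℓ := by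
  rw [integral_finsetSum _ fun _ _ => integrable_randomSubset_real _,
    Finset.sum_congr rfl fun a ha => by rw [integral_containsInd (hn a ha), hℓ a ha],
    Finset.sum_const, nsmul_eq_mul]

lemma variance_sum_containsInd (hn : ∀ a ∈ F, a ⊆ Finset.Icc 1 n) (hℓ : ∀ a ∈ F, a.card = ℓ) :
    variance (fun S => ∑ a ∈ F, containsInd a S) (randomSubset n p)
      = ∑ a ∈ F, ∑ b ∈ F, ((p : ℝ) ^ (a ∪ b).card - (p : ℝ) ^ (2 * ℓ)) := by
  have hR := integrable_randomSubset_real (n := n) (p := p)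
  rw [variance_eq_integral (hR _).1.aemeasurable, integral_sum_containsInd hn hℓ]
  have : ∀ S, (∑ a ∈ F, containsInd a S - F.card * (p : ℝ) ^ ℓ) ^ 2
      = ∑ a ∈ F, ∑ b ∈ F, (containsInd a S - (p : ℝ) ^ ℓ) * (containsInd b S - (p : ℝ) ^ ℓ) := by
    intro S
    rw [← Finset.sum_mul_sum, ← sq, Finset.sum_sub_distrib, Finset.sum_const, nsmul_eq_mul]
  simp only [this]
  rw [integral_finsetSum _ fun _ _ => hR _]
  refine Finset.sum_congr rfl fun a ha => ?_
  rw [integral_finsetSum _ fun _ _ => hR _]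
  exact Finset.sum_congr rfl fun b hb => integral_centered_mul hn hℓ ha hb

lemma card_union_le_two_mul (hℓ : ∀ a ∈ F, a.card = ℓ) {a b : Finset ℕ} (ha : a ∈ F)
    (hb : b ∈ F) : (a ∪ b).card ≤ 2 * ℓ := by
  have := Finset.card_union_le a b
  rw [hℓ a ha, hℓ b hb] at this
  omega

/-- Keep only the diagonal: no covariance is negative, since a union has at most `2 * ℓ` points. -/
lemma card_mul_le_variance (hn : ∀ a ∈ F, a ⊆ Finset.Icc 1 n) (hℓ : ∀ a ∈ F, a.card = ℓ) :
    F.card * ((p : ℝ) ^ ℓ * (1 - (p : ℝ) ^ ℓ))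
      ≤ variance (fun S => ∑ a ∈ F, containsInd a S) (randomSubset n p) := by
  rw [variance_sum_containsInd hn hℓ, ← nsmul_eq_mul, ← Finset.sum_const]
  refine Finset.sum_le_sum fun a ha => ?_
  calc (p : ℝ) ^ ℓ * (1 - (p : ℝ) ^ ℓ) = (p : ℝ) ^ (a ∪ a).card - (p : ℝ) ^ (2 * ℓ) := by
        rw [Finset.union_self, hℓ a ha]; ring
    _ ≤ _ := Finset.single_le_sum
        (f := fun b => (p : ℝ) ^ (a ∪ b).card - (p : ℝ) ^ (2 * ℓ)) (fun b hb => sub_nonneg.2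
          (pow_le_pow_of_le_one p.2.1 p.2.2 (card_union_le_two_mul hℓ ha hb))) ha

/-- Bernoulli's inequality for `(q⁻¹) ^ r`. In use `r` is the size of an intersection, so
covariances are bounded below linearly in the overlap. -/
lemma pow_sub_pow_two_mul_ge {q : ℝ} (hq0 : 0 < q) {ℓ r u : ℕ} (hu : u + r = 2 * ℓ)
    (hℓ : 0 < ℓ) : q ^ (2 * ℓ - 1) * (1 - q) * r ≤ q ^ u - q ^ (2 * ℓ) := by
  have h1 : 1 + (r : ℝ) * (q⁻¹ - 1) ≤ (q⁻¹) ^ r := by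
    have := one_add_mul_le_pow (a := q⁻¹ - 1) (by linarith [inv_pos.2 hq0]) r
    simpa using this
  have h2 : q ^ u = q ^ (2 * ℓ) * (q⁻¹) ^ r := by
    rw [← hu, pow_add, inv_pow, mul_assoc, mul_inv_cancel₀ (by positivity), mul_one]
  have h3 : q ^ (2 * ℓ) = q ^ (2 * ℓ - 1) * q := by
    rw [← pow_succ]; congr 1; omega
  calc q ^ (2 * ℓ - 1) * (1 - q) * r = q ^ (2 * ℓ) * (1 + r * (q⁻¹ - 1)) - q ^ (2 * ℓ) := by
        rw [h3]; field_simp; ring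
    _ ≤ _ := by rw [h2]; gcongr

/-- Cauchy-Schwarz over the `n` points: the degrees sum to `F.card * ℓ`, and their squares sum to
the total intersection size. -/
lemma sq_card_mul_le_sum_card_inter (hn : ∀ a ∈ F, a ⊆ Finset.Icc 1 n)
    (hℓ : ∀ a ∈ F, a.card = ℓ) :
    ((F.card * ℓ : ℕ) : ℝ) ^ 2 ≤ n * ∑ a ∈ F, ∑ b ∈ F, ((a ∩ b).card : ℝ) := by
  have hdeg : ∀ a ∈ F, ∀ b : Finset ℕ, ((a ∩ b).card : ℝ)
      = ∑ x ∈ Finset.Icc 1 n, (if x ∈ a then (1 : ℝ) else 0) * (if x ∈ b then 1 else 0) := by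
    intro a ha b
    have : ∀ x, (if x ∈ a then (1 : ℝ) else 0) * (if x ∈ b then 1 else 0)
        = if x ∈ a ∩ b then 1 else 0 := by
      intro x
      by_cases h : x ∈ a <;> by_cases h' : x ∈ b <;> simp [h, h']
    rw [Finset.sum_congr rfl fun x _ => this x, Finset.sum_boole, Finset.filter_mem_eq_inter,
      Finset.inter_eq_right.2 (Finset.inter_subset_left.trans (hn a ha))]
  have h1 : ∑ a ∈ F, ∑ b ∈ F, ((a ∩ b).card : ℝ)
      = ∑ x ∈ Finset.Icc 1 n, (∑ a ∈ F, if x ∈ a then (1 : ℝ) else 0) ^ 2 := by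
    rw [Finset.sum_congr rfl fun a ha => Finset.sum_congr rfl fun b _ => hdeg a ha b]
    simp only [sq, Finset.sum_mul_sum]
    rw [Finset.sum_comm' (s := Finset.Icc 1 n) (t' := F) (s' := fun _ => Finset.Icc 1 n)
      (t := fun _ => F) (fun x y => Iff.rfl)]
    exact Finset.sum_congr rfl fun a _ => Finset.sum_comm
  have h2 : ((F.card * ℓ : ℕ) : ℝ)
      = ∑ x ∈ Finset.Icc 1 n, ∑ a ∈ F, if x ∈ a then (1 : ℝ) else 0 := by
    rw [Finset.sum_comm, Finset.sum_congr rfl fun a ha => ?_, Finset.sum_const (ℓ : ℝ),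
      nsmul_eq_mul]
    · push_cast; rfl
    · rw [Finset.sum_boole, Finset.filter_mem_eq_inter, Finset.inter_eq_right.2 (hn a ha), hℓ a ha]
  rw [h1, h2]
  simpa using sq_sum_le_card_mul_sum_sq (s := Finset.Icc 1 n)
    (f := fun x => ∑ a ∈ F, if x ∈ a then (1 : ℝ) else 0)

lemma pow_mul_sq_card_mul_le_variance (hn : ∀ a ∈ F, a ⊆ Finset.Icc 1 n)
    (hℓ : ∀ a ∈ F, a.card = ℓ) (hpos : 0 < ℓ) (hp : 0 < p) :
    (p : ℝ) ^ (2 * ℓ - 1) * (1 - p) * ((F.card * ℓ : ℕ) : ℝ) ^ 2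
      ≤ n * variance (fun S => ∑ a ∈ F, containsInd a S) (randomSubset n p) := by
  have hp' : (0 : ℝ) < p := hp
  have hp1 : 0 ≤ 1 - (p : ℝ) := sub_nonneg.2 p.2.2
  calc _ ≤ (p : ℝ) ^ (2 * ℓ - 1) * (1 - p) * (n * ∑ a ∈ F, ∑ b ∈ F, ((a ∩ b).card : ℝ)) := by
        gcongr
        exact sq_card_mul_le_sum_card_inter hn hℓ
    _ = n * ∑ a ∈ F, ∑ b ∈ F, (p : ℝ) ^ (2 * ℓ - 1) * (1 - p) * ((a ∩ b).card : ℝ) := by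
        simp only [← Finset.mul_sum]; ring
    _ ≤ _ := by
        rw [variance_sum_containsInd hn hℓ]
        gcongr with a ha b hb
        refine pow_sub_pow_two_mul_ge hp' ?_ hpos
        rw [Finset.card_union_add_card_inter, hℓ a ha, hℓ b hb, two_mul]

lemma variance_eq_sum_meeting (hn : ∀ a ∈ F, a ⊆ Finset.Icc 1 n) (hℓ : ∀ a ∈ F, a.card = ℓ) :
    variance (fun S => ∑ a ∈ F, containsInd a S) (randomSubset n p)
      = ∑ a ∈ F, ∑ b ∈ meeting F a, ((p : ℝ) ^ (a ∪ b).card - (p : ℝ) ^ (2 * ℓ)) := by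
  rw [variance_sum_containsInd hn hℓ]
  refine Finset.sum_congr rfl fun a ha => (Finset.sum_subset (meeting_subset F a) ?_).symm
  intro b hb hb'
  have : Disjoint a b := by
    rw [mem_meeting] at hb'
    tauto
  rw [Finset.card_union_of_disjoint this, hℓ a ha, hℓ b hb, two_mul, sub_self]

/-- If `c` meets `b` instead of `a`, exchanging `a` and `b` gives a triple of the required kind;
hence the factor `2`. -/
lemma tripleSum_union_le {q : ℝ} (hq : 0 ≤ q) :
    ∑ a ∈ F, ∑ b ∈ meeting F a, ∑ c ∈ meeting F a ∪ meeting F b, q ^ (a ∪ b ∪ c).card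
      ≤ 2 * tripleSum F q := by
  have h1 : ∑ a ∈ F, ∑ b ∈ meeting F a, ∑ c ∈ meeting F a ∪ meeting F b, q ^ (a ∪ b ∪ c).card
      ≤ ∑ a ∈ F, ∑ b ∈ meeting F a, (∑ c ∈ meeting F a, q ^ (a ∪ b ∪ c).card
        + ∑ c ∈ meeting F b, q ^ (a ∪ b ∪ c).card) := by
    gcongr with a ha b hb
    rw [← Finset.sum_union_inter]
    exact le_add_of_nonneg_right (Finset.sum_nonneg fun _ _ => pow_nonneg hq _)
  refine h1.trans_eq ?_
  simp only [Finset.sum_add_distrib]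
  rw [two_mul, tripleSum]
  congr 1
  rw [Finset.sum_comm' (t' := F) (s' := fun b => meeting F b)]
  · simp only [Finset.union_comm]
  · intro a b
    simp only [mem_meeting, disjoint_comm]
    tauto

/-- Bound each centred indicator by indicator plus mean and expand. Replacing an indicator by its
mean turns the size of a union into a sum of sizes, which only lowers the power of `p`; this leaves
`8 + 4 * 2 = 16` terms. -/
lemma integral_abs_mul_mul_le (hn : ∀ a ∈ F, a ⊆ Finset.Icc 1 n) (hℓ : ∀ a ∈ F, a.card = ℓ)
    {a b c : Finset ℕ} (ha : a ∈ F) (hb : b ∈ F) (hc : c ∈ F) :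
    ∫ S, |containsInd a S - (p : ℝ) ^ ℓ| * |containsInd b S - (p : ℝ) ^ ℓ|
        * |containsInd c S - (p : ℝ) ^ ℓ| ∂(randomSubset n p)
      + (∫ S, |containsInd a S - (p : ℝ) ^ ℓ| * |containsInd b S - (p : ℝ) ^ ℓ|
          ∂(randomSubset n p)) * ∫ S, |containsInd c S - (p : ℝ) ^ ℓ| ∂(randomSubset n p)
      ≤ 16 * (p : ℝ) ^ (a ∪ b ∪ c).card := by
  have hR := integrable_randomSubset_real (n := n) (p := p)
  have hp0 : (0 : ℝ) ≤ p := p.2.1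
  have hp1 : (p : ℝ) ≤ 1 := p.2.2
  set q : ℝ := (p : ℝ) ^ ℓ with hq
  have hq0 : 0 ≤ q := pow_nonneg hp0 _
  have habs : ∀ d S, |containsInd d S - q| ≤ containsInd d S + q := fun d S => by
    refine (abs_sub _ _).trans ?_
    rw [abs_of_nonneg (containsInd_nonneg d S), abs_of_nonneg hq0]
  have hadd : ∀ d S, 0 ≤ containsInd d S + q := fun d S => add_nonneg (containsInd_nonneg d S) hq0
  have hmul : ∀ {x : ℝ} {d : Finset ℕ}, x ≤ (p : ℝ) ^ d.card → ∀ {e : Finset ℕ}, e ∈ F →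
      x * q ≤ (p : ℝ) ^ (d ∪ e).card := by
    intro x d hx e he
    calc x * q ≤ (p : ℝ) ^ d.card * q := by gcongr
      _ = (p : ℝ) ^ (d.card + e.card) := by rw [hq, pow_add, hℓ e he]
      _ ≤ _ := pow_le_pow_of_le_one hp0 hp1 (Finset.card_union_le _ _)
  set w : ℝ := (p : ℝ) ^ (a ∪ b ∪ c).card with hw
  have hE : ∀ {d}, d ∈ F → ∫ S, containsInd d S ∂(randomSubset n p) = q := fun hd => by
    rw [integral_containsInd (hn _ hd), hℓ _ hd]
  have hE₂ : ∀ {d e}, d ∈ F → e ∈ F →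
      ∫ S, containsInd (d ∪ e) S ∂(randomSubset n p) = (p : ℝ) ^ (d ∪ e).card := fun hd he =>
    integral_containsInd (Finset.union_subset (hn _ hd) (hn _ he))
  have hqa : ∀ {d}, d ∈ F → q = (p : ℝ) ^ d.card := fun hd => by rw [hℓ _ hd]
  have hqqq : q * q * q ≤ w := hmul (hmul (hqa ha).le hb) hc
  have hab : (p : ℝ) ^ (a ∪ b).card * q ≤ w := hmul le_rfl hc
  have hac : (p : ℝ) ^ (a ∪ c).card * q ≤ w := by
    rw [hw, Finset.union_right_comm]; exact hmul le_rfl hb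
  have hbc : (p : ℝ) ^ (b ∪ c).card * q ≤ w := by
    rw [hw, Finset.union_assoc, Finset.union_comm a]; exact hmul le_rfl ha
  have h1 : ∫ S, |containsInd a S - q| * |containsInd b S - q| * |containsInd c S - q|
      ∂(randomSubset n p) ≤ 8 * w := by
    calc _ ≤ ∫ S, (containsInd (a ∪ b ∪ c) S + q * containsInd (a ∪ b) S
            + q * containsInd (a ∪ c) S + q * containsInd (b ∪ c) S
            + q * q * containsInd a S + q * q * containsInd b S + q * q * containsInd c S
            + q * q * q) ∂(randomSubset n p) := by
          refine integral_mono (hR _) (hR _) fun S => ?_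
          calc _ ≤ (containsInd a S + q) * (containsInd b S + q) * (containsInd c S + q) := by
                exact mul_le_mul (mul_le_mul (habs _ _) (habs _ _) (abs_nonneg _) (hadd _ _))
                  (habs _ _) (abs_nonneg _) (mul_nonneg (hadd _ _) (hadd _ _))
            _ = _ := by
                simp only [← containsInd_mul]
                ring
      _ ≤ _ := by
          rw [integral_add (hR _) (hR _), integral_add (hR _) (hR _), integral_add (hR _) (hR _),
            integral_add (hR _) (hR _), integral_add (hR _) (hR _), integral_add (hR _) (hR _),
            integral_add (hR _) (hR _)]
          simp only [integral_const_mul, hE ha, hE hb, hE hc, hE₂ ha hb, hE₂ ha hc, hE₂ hb hc]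
          rw [integral_containsInd (Finset.union_subset (Finset.union_subset (hn a ha) (hn b hb))
            (hn c hc))]
          simp only [integral_const, probReal_univ, one_smul]
          linarith
  have h2 : ∫ S, |containsInd a S - q| * |containsInd b S - q| ∂(randomSubset n p)
      ≤ 4 * (p : ℝ) ^ (a ∪ b).card := by
    calc _ ≤ ∫ S, (containsInd (a ∪ b) S + q * containsInd a S + q * containsInd b S
            + q * q) ∂(randomSubset n p) := by
          refine integral_mono (hR _) (hR _) fun S => ?_
          calc _ ≤ (containsInd a S + q) * (containsInd b S + q) := by
                exact mul_le_mul (habs _ _) (habs _ _) (abs_nonneg _) (hadd _ _)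
            _ = _ := by
                simp only [← containsInd_mul]
                ring
      _ ≤ _ := by
          rw [integral_add (hR _) (hR _), integral_add (hR _) (hR _), integral_add (hR _) (hR _)]
          simp only [integral_const_mul, hE ha, hE hb, hE₂ ha hb]
          simp only [integral_const, probReal_univ, one_smul]
          linarith [hmul (hqa ha).le hb]
  have h3 : ∫ S, |containsInd c S - q| ∂(randomSubset n p) ≤ 2 * q := by
    calc _ ≤ ∫ S, (containsInd c S + q) ∂(randomSubset n p) :=
          integral_mono (hR _) (hR _) fun S => habs c S
      _ = _ := by
          rw [integral_add (hR _) (hR _), hE hc]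
          simp only [integral_const, probReal_univ, one_smul]
          ring
  calc _ ≤ 8 * w + 4 * (p : ℝ) ^ (a ∪ b).card * (2 * q) := by
        refine add_le_add h1 (mul_le_mul h2 h3 (integral_nonneg fun S => abs_nonneg _)
          (by positivity))
    _ ≤ 16 * w := by linarith

open Complex in
lemma norm_integral_sub_gaussian_le (hn : ∀ a ∈ F, a ⊆ Finset.Icc 1 n)
    (hℓ : ∀ a ∈ F, a.card = ℓ) {σ : ℝ} (hσ : 0 < σ)
    (hσ' : σ ^ 2 = variance (fun S => ∑ a ∈ F, containsInd a S) (randomSubset n p)) (t : ℝ) :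
    ‖(∫ S, cexp ((t * ((∑ a ∈ F, containsInd a S - F.card * (p : ℝ) ^ ℓ) / σ) : ℝ) * I)
          ∂(randomSubset n p)) - cexp (-(t ^ 2 / 2 : ℝ))‖
      ≤ 64 * |t| ^ 3 * (tripleSum F p / σ ^ 3) := by
  set q : ℝ := (p : ℝ) ^ ℓ with hq
  have hR := integrable_randomSubset_real (n := n) (p := p)
  have h := norm_integral_cexp_sub_gaussian_le (integrable_randomSubset (n := n) (p := p)) F
    (meeting F) (fun a _ => meeting_subset F a) (fun a S => (containsInd a S - q) / σ)
    (fun a ha t => ?_) (fun a ha b hb t => ?_) ?_ t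
  · have h1 : ∀ S, ∑ a ∈ F, (containsInd a S - q) / σ
        = (∑ a ∈ F, containsInd a S - F.card * q) / σ := fun S => by
      rw [← Finset.sum_div, Finset.sum_sub_distrib, Finset.sum_const, nsmul_eq_mul]
    simp only [h1] at h
    refine h.trans ?_
    have h2 : ∀ x, |x / σ| = |x| / σ := fun x => by rw [abs_div, abs_of_pos hσ]
    have h3 : ∑ a ∈ F, ∑ b ∈ meeting F a, ∑ c ∈ meeting F a ∪ meeting F b,
        (∫ S, |(containsInd a S - q) / σ| * |(containsInd b S - q) / σ|
            * |(containsInd c S - q) / σ| ∂(randomSubset n p)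
          + (∫ S, |(containsInd a S - q) / σ| * |(containsInd b S - q) / σ| ∂(randomSubset n p))
            * ∫ S, |(containsInd c S - q) / σ| ∂(randomSubset n p))
        ≤ ∑ a ∈ F, ∑ b ∈ meeting F a, ∑ c ∈ meeting F a ∪ meeting F b,
          16 / σ ^ 3 * (p : ℝ) ^ (a ∪ b ∪ c).card := by
      gcongr with a ha b hb c hc
      have hb' := meeting_subset F a hb
      have hc' : c ∈ F := (Finset.union_subset (meeting_subset F a) (meeting_subset F b)) hc
      have := integral_abs_mul_mul_le (p := p) hn hℓ ha hb' hc'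
      simp only [h2]
      have e1 : ∀ x y z : ℝ, x / σ * (y / σ) * (z / σ) = x * y * z / σ ^ 3 := fun x y z => by
        field_simp
      have e2 : ∀ x y : ℝ, x / σ * (y / σ) = x * y / σ ^ 2 := fun x y => by
        field_simp
      simp only [e1]
      simp only [e2]
      rw [integral_div, integral_div, integral_div]
      have e3 : ∀ x y z : ℝ, x / σ ^ 3 + y / σ ^ 2 * (z / σ) = (x + y * z) / σ ^ 3 :=
        fun x y z => by field_simp
      rw [e3, div_mul_eq_mul_div]
      gcongr
    -- The constant `64` is `2` from the general bound, `16` from the moments and `2` from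
    -- `tripleSum_union_le`.
    calc _ ≤ 2 * |t| ^ 3 * (16 / σ ^ 3 * (2 * tripleSum F p)) := by
          gcongr
          refine h3.trans ?_
          simp only [← Finset.mul_sum]
          gcongr
          exact tripleSum_union_le p.2.1
      _ = _ := by ring
  · have h0 : ∫ S, (containsInd a S - q) / σ ∂(randomSubset n p) = 0 := by
      rw [integral_div, integral_sub (hR _) (hR _), integral_containsInd (hn a ha), hℓ a ha]
      simp [hq]
    have := integral_mul_cexp_sum (n := n) (p := p) a (F \ meeting F a) (fun b hb => ?_)
      (fun S => (containsInd a S - q) / σ)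
      (fun S => by rw [containsInd_inter (Finset.Subset.refl a)]) (fun x => (x - q) / σ) t
    · rw [this, h0]
      simp
    · rw [Finset.mem_sdiff, mem_meeting] at hb
      tauto
  · refine integral_mul_cexp_sum (n := n) (p := p) (a ∪ b) (F \ (meeting F a ∪ meeting F b))
      (fun c hc => ?_) (fun S => (containsInd a S - q) / σ * ((containsInd b S - q) / σ))
      (fun S => ?_) (fun x => (x - q) / σ) t
    · rw [Finset.mem_sdiff, Finset.mem_union, mem_meeting, mem_meeting] at hc
      rw [Finset.disjoint_union_left]
      tauto
    · rw [containsInd_inter Finset.subset_union_left, containsInd_inter Finset.subset_union_right]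
  · have h1 : ∀ a ∈ F, ∀ b ∈ meeting F a, ∫ S, (containsInd a S - q) / σ
        * ((containsInd b S - q) / σ) ∂(randomSubset n p)
        = ((p : ℝ) ^ (a ∪ b).card - (p : ℝ) ^ (2 * ℓ)) / σ ^ 2 := by
      intro a ha b hb
      rw [← integral_centered_mul hn hℓ ha (meeting_subset F a hb), ← integral_div]
      congr 1 with S
      rw [div_mul_div_comm, ← sq]
    rw [Finset.sum_congr rfl fun a ha => Finset.sum_congr rfl fun b hb => h1 a ha b hb]
    simp only [← Finset.sum_div]
    rw [← variance_eq_sum_meeting hn hℓ, hσ', div_self (hσ' ▸ (pow_pos hσ 2).ne')]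

end SetFamilies

/-! ### Counting pairs and triples in sparse families -/

section TripleSum

/-- The members of `F` that meet `A` in exactly one point. -/
def meetingOnce (F : Finset (Finset ℕ)) (A : Finset ℕ) : Finset (Finset ℕ) :=
  {b ∈ F | (A ∩ b).card = 1}

/-- The members of `F` that meet `A` in at least two points. -/
def meetingTwice (F : Finset (Finset ℕ)) (A : Finset ℕ) : Finset (Finset ℕ) :=
  {b ∈ F | 2 ≤ (A ∩ b).card}

/-- A family of `ℓ`-sets in which every point has degree at most `M`, every pair of points has
codegree at most `ℓ ^ 2`, and in which the sets that meet a given member at least twice have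
small total weight. -/
structure IsSparse (F : Finset (Finset ℕ)) (ℓ : ℕ) (M K : ℝ) : Prop where
  card_eq : ∀ a ∈ F, a.card = ℓ
  degree_le : ∀ x, (({a ∈ F | x ∈ a} : Finset (Finset ℕ)).card : ℝ) ≤ M
  codegree_le : ∀ x y, x ≠ y → ({a ∈ F | x ∈ a ∧ y ∈ a} : Finset (Finset ℕ)).card ≤ ℓ ^ 2
  sum_le : ∀ a ∈ F, ∀ t : ℝ, 0 ≤ t → t ≤ 1 / 2 →
    ∑ c ∈ (meetingTwice F a).erase a, t ^ ((c \ a).card - 1) ≤ K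

variable {F : Finset (Finset ℕ)} {ℓ : ℕ} {M K : ℝ}

lemma mem_meetingOnce {A b : Finset ℕ} : b ∈ meetingOnce F A ↔ b ∈ F ∧ (A ∩ b).card = 1 :=
  Finset.mem_filter

lemma mem_meetingTwice {A b : Finset ℕ} : b ∈ meetingTwice F A ↔ b ∈ F ∧ 2 ≤ (A ∩ b).card :=
  Finset.mem_filter

lemma not_disjoint_iff_card_inter_pos {a b : Finset ℕ} : ¬ Disjoint a b ↔ 0 < (a ∩ b).card := by
  rw [Finset.disjoint_iff_inter_eq_empty, Finset.card_pos, Finset.nonempty_iff_ne_empty]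

lemma sum_meeting (a : Finset ℕ) (f : Finset ℕ → ℝ) :
    ∑ b ∈ meeting F a, f b = ∑ b ∈ meetingTwice F a, f b + ∑ b ∈ meetingOnce F a, f b := by
  rw [← Finset.sum_union]
  · congr 1
    ext b
    simp only [mem_meeting, Finset.mem_union, mem_meetingTwice, mem_meetingOnce,
      not_disjoint_iff_card_inter_pos, ← and_or_left]
    exact and_congr_right fun _ => by omega
  · rw [Finset.disjoint_left]
    intro b hb hb'
    have h1 := (mem_meetingTwice.1 hb).2
    have h2 := (mem_meetingOnce.1 hb').2
    omega

lemma card_inter_add_card_sdiff (a b : Finset ℕ) : (a ∩ b).card + (b \ a).card = b.card := by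
  rw [Finset.inter_comm, Finset.card_inter_add_card_sdiff]

/-- Union bound over the ordered pairs of distinct points of `A`, one of which must lie in each
counted set. -/
lemma card_meetingTwice_le (hcod : ∀ x y, x ≠ y →
    ({a ∈ F | x ∈ a ∧ y ∈ a} : Finset (Finset ℕ)).card ≤ ℓ ^ 2) (A : Finset ℕ) :
    (meetingTwice F A).card ≤ A.card ^ 2 * ℓ ^ 2 := by
  have hsub : meetingTwice F A ⊆ A.offDiag.biUnion fun x => {a ∈ F | x.1 ∈ a ∧ x.2 ∈ a} := by
    intro b hb
    obtain ⟨hb, hAb⟩ := mem_meetingTwice.1 hb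
    obtain ⟨x, hx, y, hy, hxy⟩ := Finset.one_lt_card.1 hAb
    rw [Finset.mem_inter] at hx hy
    exact Finset.mem_biUnion.2 ⟨(x, y), Finset.mem_offDiag.2 ⟨hx.1, hy.1, hxy⟩,
      Finset.mem_filter.2 ⟨hb, hx.2, hy.2⟩⟩
  calc (meetingTwice F A).card
      ≤ ∑ x ∈ A.offDiag, ({a ∈ F | x.1 ∈ a ∧ x.2 ∈ a} : Finset (Finset ℕ)).card :=
        (Finset.card_le_card hsub).trans Finset.card_biUnion_le
    _ ≤ ∑ _x ∈ A.offDiag, ℓ ^ 2 := Finset.sum_le_sum fun x hx =>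
        hcod _ _ (Finset.mem_offDiag.1 hx).2.2
    _ = A.offDiag.card * ℓ ^ 2 := by rw [Finset.sum_const, smul_eq_mul]
    _ ≤ _ := by
        gcongr
        rw [Finset.offDiag_card, sq]
        exact Nat.sub_le _ _

namespace IsSparse

variable (h : IsSparse F ℓ M K)
include h

lemma card_meeting_le (A : Finset ℕ) : ((meeting F A).card : ℝ) ≤ A.card * M := by
  have hsub : meeting F A ⊆ A.biUnion fun x => {a ∈ F | x ∈ a} := by
    intro b hb
    obtain ⟨hb, hAb⟩ := mem_meeting.1 hb
    obtain ⟨x, hx, hx'⟩ := Finset.not_disjoint_iff.1 hAb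
    exact Finset.mem_biUnion.2 ⟨x, hx, Finset.mem_filter.2 ⟨hb, hx'⟩⟩
  calc ((meeting F A).card : ℝ) ≤ ((∑ x ∈ A, ({a ∈ F | x ∈ a} : Finset (Finset ℕ)).card : ℕ) : ℝ) :=
        by exact_mod_cast (Finset.card_le_card hsub).trans Finset.card_biUnion_le
    _ ≤ ∑ _x ∈ A, M := by
        push_cast
        exact Finset.sum_le_sum fun x _ => h.degree_le x
    _ = _ := by rw [Finset.sum_const, nsmul_eq_mul]

lemma card_meetingOnce_le {a : Finset ℕ} (ha : a ∈ F) :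
    ((meetingOnce F a).card : ℝ) ≤ ℓ * M := by
  rw [← h.card_eq a ha]
  refine le_trans ?_ (h.card_meeting_le a)
  exact_mod_cast Finset.card_le_card fun b hb => by
    rw [mem_meeting, not_disjoint_iff_card_inter_pos]
    rw [mem_meetingOnce] at hb
    exact ⟨hb.1, by omega⟩

lemma one_le_card_sdiff {a c : Finset ℕ} (ha : a ∈ F) (hc : c ∈ F) (hne : c ≠ a) :
    1 ≤ (c \ a).card := by
  rw [Nat.one_le_iff_ne_zero, Finset.card_ne_zero, Finset.sdiff_nonempty]
  intro hsub
  exact hne (Finset.eq_of_subset_of_card_le hsub (by rw [h.card_eq a ha, h.card_eq c hc]))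

lemma card_sdiff_of_meetingOnce {a b : Finset ℕ} (hb : b ∈ meetingOnce F a) :
    (b \ a).card = ℓ - 1 := by
  rw [mem_meetingOnce] at hb
  have := card_inter_add_card_sdiff a b
  rw [h.card_eq b hb.1] at this
  omega

lemma sum_erase_meetingTwice_pow_le {a : Finset ℕ} (ha : a ∈ F) {t : ℝ} (ht0 : 0 ≤ t)
    (ht : t ≤ 1 / 2) : ∑ c ∈ (meetingTwice F a).erase a, t ^ (c \ a).card ≤ t * K := by
  refine le_trans (le_of_eq ?_) (mul_le_mul_of_nonneg_left (h.sum_le a ha t ht0 ht) ht0)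
  rw [Finset.mul_sum]
  refine Finset.sum_congr rfl fun c hc => ?_
  rw [Finset.mem_erase, mem_meetingTwice] at hc
  have := h.one_le_card_sdiff ha hc.2.1 hc.1
  rw [← pow_succ', Nat.sub_add_cancel this]

lemma mem_meetingTwice_self (hℓ : 2 ≤ ℓ) {a : Finset ℕ} (ha : a ∈ F) : a ∈ meetingTwice F a := by
  rw [mem_meetingTwice, Finset.inter_self, h.card_eq a ha]
  exact ⟨ha, hℓ⟩

lemma nonneg_of_mem {a : Finset ℕ} (ha : a ∈ F) : 0 ≤ K :=
  (Finset.sum_nonneg fun _ _ => pow_nonneg (by norm_num) _).trans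
    (h.sum_le a ha (1 / 2) (by norm_num) le_rfl)

lemma sum_meetingTwice_pow_le (hℓ : 2 ≤ ℓ) {a : Finset ℕ} (ha : a ∈ F) {t : ℝ} (ht0 : 0 ≤ t)
    (ht : t ≤ 1 / 2) : ∑ c ∈ meetingTwice F a, t ^ (c \ a).card ≤ 1 + K := by
  rw [← Finset.add_sum_erase _ _ (h.mem_meetingTwice_self hℓ ha)]
  refine add_le_add (by simp) ((h.sum_erase_meetingTwice_pow_le ha ht0 ht).trans ?_)
  exact mul_le_of_le_one_left (h.nonneg_of_mem ha) (by linarith)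

/-- One common point leaves `ℓ - 1` new ones. For larger overlaps, distinctness guarantees a new
point, which gives the spare factor `q` before `K`. -/
lemma sum_erase_meeting_pow_le (hℓ : 2 ≤ ℓ) {a : Finset ℕ} (ha : a ∈ F) {q : ℝ} (hq0 : 0 ≤ q)
    (hq : q ≤ 1 / 2) :
    ∑ b ∈ (meeting F a).erase a, q ^ (a ∪ b).card ≤ q ^ ℓ * (ℓ * M * q ^ (ℓ - 1) + q * K) := by
  have h1 : ∀ b, q ^ (a ∪ b).card = q ^ ℓ * q ^ (b \ a).card := fun b => by
    rw [← pow_add, ← h.card_eq a ha, Finset.union_comm, ← Finset.card_sdiff_add_card, add_comm]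
  simp only [h1, ← Finset.mul_sum]
  refine mul_le_mul_of_nonneg_left ?_ (pow_nonneg hq0 _)
  have h2 := sum_meeting (F := F) a (fun b => q ^ (b \ a).card)
  have hmem : a ∈ meeting F a := by
    rw [mem_meeting, not_disjoint_iff_card_inter_pos, Finset.inter_self, h.card_eq a ha]
    exact ⟨ha, by omega⟩
  rw [← Finset.add_sum_erase _ _ hmem, ← Finset.add_sum_erase _ _ (h.mem_meetingTwice_self hℓ ha),
    add_assoc] at h2
  rw [add_left_cancel h2, add_comm]
  refine add_le_add ?_ (h.sum_erase_meetingTwice_pow_le ha hq0 hq)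
  rw [Finset.sum_congr rfl fun b hb => by rw [h.card_sdiff_of_meetingOnce hb], Finset.sum_const,
    nsmul_eq_mul]
  exact mul_le_mul_of_nonneg_right (h.card_meetingOnce_le ha) (pow_nonneg hq0 _)

/-- The union has at least as many new points as the average of `b` and `c`, so the sum factors at
the price of replacing `q` by `√q`. This is why the weights in `IsSparse` are controlled up to `1 /
2` while `q ≤ 1 / 4`. -/
lemma sum_twice_twice_le (hℓ : 2 ≤ ℓ) {a : Finset ℕ} (ha : a ∈ F) {q : ℝ} (hq0 : 0 ≤ q)
    (hq : q ≤ 1 / 4) :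
    ∑ b ∈ meetingTwice F a, ∑ c ∈ meetingTwice F a, q ^ ((b ∪ c) \ a).card ≤ (1 + K) ^ 2 := by
  have hs0 := Real.sqrt_nonneg q
  have hs : √q ≤ 1 / 2 := Real.sqrt_le_iff.2 ⟨by norm_num, by linarith⟩
  have hT := h.sum_meetingTwice_pow_le hℓ ha hs0 hs
  calc _ ≤ ∑ b ∈ meetingTwice F a, ∑ c ∈ meetingTwice F a,
        √q ^ (b \ a).card * √q ^ (c \ a).card := by
        gcongr with b hb c hc
        nth_rewrite 1 [← Real.sq_sqrt hq0]
        rw [← pow_mul, ← pow_add]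
        refine pow_le_pow_of_le_one hs0 (by linarith) ?_
        have h1 := Finset.card_le_card (Finset.sdiff_subset_sdiff
          (Finset.subset_union_left (s₁ := b) (s₂ := c)) (Finset.Subset.refl a))
        have h2 := Finset.card_le_card (Finset.sdiff_subset_sdiff
          (Finset.subset_union_right (s₁ := b) (s₂ := c)) (Finset.Subset.refl a))
        omega
    _ = (∑ c ∈ meetingTwice F a, √q ^ (c \ a).card) ^ 2 := by
        rw [sq, Finset.sum_mul_sum]
    _ ≤ _ := by
        gcongr

lemma card_meetingTwice_union_le {a c : Finset ℕ} (ha : a ∈ F) (hc : c ∈ F) :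
    ((meetingTwice F (a ∪ c)).card : ℝ) ≤ 4 * (ℓ : ℝ) ^ 4 := by
  have h1 := card_meetingTwice_le h.codegree_le (a ∪ c)
  have h2 := card_union_le_two_mul h.card_eq ha hc
  have : (meetingTwice F (a ∪ c)).card ≤ 4 * ℓ ^ 4 := by
    calc _ ≤ _ := h1
      _ ≤ (2 * ℓ) ^ 2 * ℓ ^ 2 := by gcongr
      _ = _ := by ring
  exact_mod_cast this

/-- Typically `b` meets `a ∪ c` just once and adds `ℓ - 1` points to those of `c`. The at most `4 *
ℓ ^ 4` exceptional `b` are charged `q ^ (ℓ - 1)` only. -/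
lemma sum_twice_once_le (hℓ : 2 ≤ ℓ) {a : Finset ℕ} (ha : a ∈ F) {q : ℝ} (hq0 : 0 ≤ q)
    (hq : q ≤ 1 / 4) :
    ∑ c ∈ meetingTwice F a, ∑ b ∈ meetingOnce F a, q ^ ((b ∪ c) \ a).card
      ≤ ℓ * M * q ^ (ℓ - 1) * (1 + K) + 4 * ℓ ^ 8 * q ^ (ℓ - 1) := by
  have hpow : ∀ {i j : ℕ}, i ≤ j → q ^ j ≤ q ^ i := fun hij =>
    pow_le_pow_of_le_one hq0 (by linarith) hij
  have h1 : ∀ c ∈ meetingTwice F a, ∑ b ∈ meetingOnce F a, q ^ ((b ∪ c) \ a).card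
      ≤ ℓ * M * q ^ (ℓ - 1) * q ^ (c \ a).card + 4 * ℓ ^ 4 * q ^ (ℓ - 1) := by
    intro c hc
    have hcF := (mem_meetingTwice.1 hc).1
    calc ∑ b ∈ meetingOnce F a, q ^ ((b ∪ c) \ a).card
        ≤ ∑ b ∈ meetingOnce F a, (q ^ (ℓ - 1) * q ^ (c \ a).card
            + if b ∈ meetingTwice F (a ∪ c) then q ^ (ℓ - 1) else 0) := by
          refine Finset.sum_le_sum fun b hb => ?_
          have hbF := (mem_meetingOnce.1 hb).1
          split_ifs with hb'
          · refine le_add_of_nonneg_of_le (by positivity) (hpow ?_)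
            rw [← h.card_sdiff_of_meetingOnce hb]
            exact Finset.card_le_card (Finset.sdiff_subset_sdiff Finset.subset_union_left
              (Finset.Subset.refl a))
          · rw [add_zero, ← pow_add]
            refine hpow ?_
            have e1 : ((a ∪ c) ∩ b).card ≤ 1 := by
              by_contra hcon
              exact hb' (mem_meetingTwice.2 ⟨hbF, by omega⟩)
            have e2 := card_inter_add_card_sdiff (a ∪ c) b
            rw [h.card_eq b hbF] at e2
            have e3 := Finset.card_sdiff_add_card (b ∪ c) a
            have e4 := Finset.card_sdiff_add_card c a
            have e5 := Finset.card_sdiff_add_card b (a ∪ c)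
            have e6 : b ∪ c ∪ a = b ∪ (a ∪ c) := by
              rw [Finset.union_assoc, Finset.union_comm c]
            rw [e6] at e3
            rw [Finset.union_comm c] at e4
            omega
      _ ≤ (meetingOnce F a).card * (q ^ (ℓ - 1) * q ^ (c \ a).card)
          + (meetingTwice F (a ∪ c)).card * q ^ (ℓ - 1) := by
          rw [Finset.sum_add_distrib, Finset.sum_const, nsmul_eq_mul, ← Finset.sum_filter,
            Finset.sum_const, nsmul_eq_mul]
          gcongr
          intro b hb
          exact (Finset.mem_filter.1 hb).2
      _ ≤ ℓ * M * (q ^ (ℓ - 1) * q ^ (c \ a).card) + 4 * ℓ ^ 4 * q ^ (ℓ - 1) := by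
          gcongr
          · exact h.card_meetingOnce_le ha
          · exact h.card_meetingTwice_union_le ha hcF
      _ = _ := by ring
  have hM : 0 ≤ ℓ * M := (Nat.cast_nonneg _).trans (h.card_meetingOnce_le ha)
  have h2 : ((meetingTwice F a).card : ℝ) ≤ ℓ ^ 4 := by
    have := card_meetingTwice_le h.codegree_le a
    rw [h.card_eq a ha] at this
    calc ((meetingTwice F a).card : ℝ) ≤ ((ℓ ^ 2 * ℓ ^ 2 : ℕ) : ℝ) := by exact_mod_cast this
      _ = _ := by push_cast; ring
  calc _ ≤ _ := Finset.sum_le_sum h1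
    _ = ℓ * M * q ^ (ℓ - 1) * (∑ c ∈ meetingTwice F a, q ^ (c \ a).card)
        + (meetingTwice F a).card * (4 * ℓ ^ 4 * q ^ (ℓ - 1)) := by
        rw [Finset.sum_add_distrib, ← Finset.mul_sum, Finset.sum_const, nsmul_eq_mul]
    _ ≤ ℓ * M * q ^ (ℓ - 1) * (1 + K) + ℓ ^ 4 * (4 * ℓ ^ 4 * q ^ (ℓ - 1)) := by
        gcongr
        exact h.sum_meetingTwice_pow_le hℓ ha hq0 (by linarith)
    _ = _ := by ring

/-- Three types of `c`: generic; meeting `a ∪ b` twice, where one new point may be lost; meeting `b`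
twice. In the last type the point of `c` on `a` may lie off `b`, which is why `IsSparse` lowers the
exponent by one. -/
lemma sum_once_once_le (hℓ : 2 ≤ ℓ) {a : Finset ℕ} (ha : a ∈ F) {q : ℝ} (hq0 : 0 ≤ q)
    (hq : q ≤ 1 / 4) :
    ∑ b ∈ meetingOnce F a, ∑ c ∈ meetingOnce F a, q ^ ((b ∪ c) \ a).card
      ≤ ℓ * M * q ^ (ℓ - 1)
        * (ℓ * M * q ^ (ℓ - 1) + 4 * ℓ ^ 4 * q ^ (ℓ - 2) + (1 + K)) := by
  have hpow : ∀ {i j : ℕ}, i ≤ j → q ^ j ≤ q ^ i := fun hij =>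
    pow_le_pow_of_le_one hq0 (by linarith) hij
  have hM : 0 ≤ ℓ * M := (Nat.cast_nonneg _).trans (h.card_meetingOnce_le ha)
  have h1 : ∀ b ∈ meetingOnce F a, ∑ c ∈ meetingOnce F a, q ^ ((b ∪ c) \ a).card
      ≤ q ^ (ℓ - 1) * (ℓ * M * q ^ (ℓ - 1) + 4 * ℓ ^ 4 * q ^ (ℓ - 2) + (1 + K)) := by
    intro b hb
    obtain ⟨hbF, hab⟩ := mem_meetingOnce.1 hb
    have hself := h.mem_meetingTwice_self hℓ hbF
    calc ∑ c ∈ meetingOnce F a, q ^ ((b ∪ c) \ a).card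
        ≤ ∑ c ∈ meetingOnce F a, (q ^ (ℓ - 1) * q ^ (ℓ - 1)
            + (if c ∈ meetingTwice F (a ∪ b) then q ^ (ℓ - 1) * q ^ (ℓ - 2) else 0)
            + if c ∈ meetingTwice F b then q ^ (ℓ - 1) * q ^ ((c \ b).card - 1) else 0) := by
          refine Finset.sum_le_sum fun c hc => ?_
          obtain ⟨hcF, hac⟩ := mem_meetingOnce.1 hc
          have n1 : 0 ≤ q ^ (ℓ - 1) * q ^ (ℓ - 1) := by positivity
          have n2 : 0 ≤ (if c ∈ meetingTwice F (a ∪ b) then q ^ (ℓ - 1) * q ^ (ℓ - 2) else 0) := by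
            split_ifs <;> positivity
          have e3 := Finset.card_sdiff_add_card (b ∪ c) a
          have e4 := Finset.card_sdiff_add_card b a
          have e5 := card_inter_add_card_sdiff a b
          have e7 := card_inter_add_card_sdiff b c
          have e13 := Finset.card_le_card (Finset.sdiff_subset_sdiff
            (Finset.subset_union_left (s₁ := b) (s₂ := c)) (Finset.Subset.refl a))
          have ec := h.card_eq c hcF
          have eb := h.card_eq b hbF
          have ea := h.card_eq a ha
          split_ifs with hb' hb'' hb''
          · refine le_add_of_nonneg_of_le (by positivity) ?_
            rw [← pow_add]
            refine hpow ?_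
            have e6 := card_inter_add_card_sdiff a (b ∪ c)
            have e8 : (a ∩ (b ∪ c)).card ≤ 2 := by
              rw [Finset.inter_union_distrib_left]
              exact (Finset.card_union_le _ _).trans (by omega)
            have e9 := Finset.card_sdiff_add_card c b
            rw [Finset.union_comm c] at e9
            omega
          · rw [add_zero]
            refine le_add_of_nonneg_of_le n1 ?_
            rw [← pow_add]
            refine hpow ?_
            have e6 := card_inter_add_card_sdiff a (b ∪ c)
            have e8 : (a ∩ (b ∪ c)).card ≤ 2 := by
              rw [Finset.inter_union_distrib_left]
              exact (Finset.card_union_le _ _).trans (by omega)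
            have e9 := Finset.card_sdiff_add_card c b
            rw [Finset.union_comm c] at e9
            have e10 : (b ∩ c).card ≤ 1 := by
              by_contra hcon
              exact hb'' (mem_meetingTwice.2 ⟨hcF, by omega⟩)
            omega
          · rw [add_zero]
            refine le_add_of_nonneg_of_le n1 ?_
            rw [← pow_add]
            refine hpow ?_
            have e6 := card_inter_add_card_sdiff a (b ∪ c)
            have e8 : (a ∩ (b ∪ c)).card ≤ 2 := by
              rw [Finset.inter_union_distrib_left]
              exact (Finset.card_union_le _ _).trans (by omega)
            have e9 := Finset.card_sdiff_add_card c b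
            rw [Finset.union_comm c] at e9
            omega
          · rw [add_zero, add_zero, ← pow_add]
            refine hpow ?_
            have e6 := card_inter_add_card_sdiff (a ∪ b) c
            have e10 : ((a ∪ b) ∩ c).card ≤ 1 := by
              by_contra hcon
              exact hb' (mem_meetingTwice.2 ⟨hcF, by omega⟩)
            have e11 := Finset.card_sdiff_add_card c (a ∪ b)
            have e12 : b ∪ c ∪ a = c ∪ (a ∪ b) := by
              rw [Finset.union_comm b, Finset.union_assoc, Finset.union_comm b]
            rw [e12] at e3
            rw [Finset.union_comm b] at e4
            omega
      _ ≤ (meetingOnce F a).card * (q ^ (ℓ - 1) * q ^ (ℓ - 1))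
          + (meetingTwice F (a ∪ b)).card * (q ^ (ℓ - 1) * q ^ (ℓ - 2))
          + ∑ c ∈ meetingTwice F b, q ^ (ℓ - 1) * q ^ ((c \ b).card - 1) := by
          rw [Finset.sum_add_distrib, Finset.sum_add_distrib, Finset.sum_const, nsmul_eq_mul,
            ← Finset.sum_filter, Finset.sum_const, nsmul_eq_mul, ← Finset.sum_filter]
          have s1 : Finset.filter (· ∈ meetingTwice F (a ∪ b)) (meetingOnce F a)
              ⊆ meetingTwice F (a ∪ b) := fun c hc => (Finset.mem_filter.1 hc).2
          have s2 : Finset.filter (· ∈ meetingTwice F b) (meetingOnce F a)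
              ⊆ meetingTwice F b := fun c hc => (Finset.mem_filter.1 hc).2
          gcongr
      _ ≤ ℓ * M * (q ^ (ℓ - 1) * q ^ (ℓ - 1)) + 4 * ℓ ^ 4 * (q ^ (ℓ - 1) * q ^ (ℓ - 2))
          + q ^ (ℓ - 1) * (1 + K) := by
          gcongr
          · exact h.card_meetingOnce_le ha
          · exact h.card_meetingTwice_union_le ha hbF
          · rw [← Finset.mul_sum, ← Finset.add_sum_erase _ _ hself]
            gcongr
            · simp
            · exact h.sum_le b hbF q hq0 (by linarith)
      _ = _ := by ring
  have hK := h.nonneg_of_mem ha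
  calc _ ≤ _ := Finset.sum_le_sum h1
    _ = (meetingOnce F a).card * (q ^ (ℓ - 1) * (ℓ * M * q ^ (ℓ - 1) + 4 * ℓ ^ 4 * q ^ (ℓ - 2)
        + (1 + K))) := by rw [Finset.sum_const, nsmul_eq_mul]
    _ ≤ ℓ * M * (q ^ (ℓ - 1) * (ℓ * M * q ^ (ℓ - 1) + 4 * ℓ ^ 4 * q ^ (ℓ - 2)
        + (1 + K))) := by
        gcongr
        exact h.card_meetingOnce_le ha
    _ = _ := by ring

/-- The four once/twice combinations fit inside one square. The term `L` absorbs the exceptional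
counts, polynomial in `ℓ` against `q ^ (ℓ - 2)`. -/
lemma tripleSum_le (hℓ : 2 ≤ ℓ) {q L : ℝ} (hq0 : 0 ≤ q) (hq : q ≤ 1 / 4)
    (hL : 4 * ℓ ^ 8 * q ^ (ℓ - 2) ≤ L) :
    tripleSum F q ≤ F.card * q ^ ℓ * (ℓ * M * q ^ (ℓ - 1) + (2 + 2 * K + L)) ^ 2 := by
  rw [tripleSum, mul_assoc, ← nsmul_eq_mul, ← Finset.sum_const]
  refine Finset.sum_le_sum fun a ha => ?_
  have h1 : ∀ b c, q ^ (a ∪ b ∪ c).card = q ^ ℓ * q ^ ((b ∪ c) \ a).card := fun b c => by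
    rw [← pow_add, ← h.card_eq a ha, Finset.union_assoc, Finset.union_comm,
      ← Finset.card_sdiff_add_card, add_comm]
  simp only [h1, ← Finset.mul_sum]
  refine mul_le_mul_of_nonneg_left ?_ (pow_nonneg hq0 _)
  have e22 := h.sum_twice_twice_le hℓ ha hq0 hq
  have e21 := h.sum_twice_once_le hℓ ha hq0 hq
  have e11 := h.sum_once_once_le hℓ ha hq0 hq
  have e12 : ∑ c ∈ meetingOnce F a, ∑ b ∈ meetingTwice F a, q ^ ((b ∪ c) \ a).card
      = ∑ c ∈ meetingTwice F a, ∑ b ∈ meetingOnce F a, q ^ ((b ∪ c) \ a).card := by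
    rw [Finset.sum_comm]
    simp only [Finset.union_comm]
  have e12' : ∑ b ∈ meetingTwice F a, ∑ c ∈ meetingOnce F a, q ^ ((b ∪ c) \ a).card
      = ∑ c ∈ meetingTwice F a, ∑ b ∈ meetingOnce F a, q ^ ((b ∪ c) \ a).card := by
    simp only [Finset.union_comm]
  have e12'' : ∑ b ∈ meetingOnce F a, ∑ c ∈ meetingTwice F a, q ^ ((b ∪ c) \ a).card
      = ∑ c ∈ meetingTwice F a, ∑ b ∈ meetingOnce F a, q ^ ((b ∪ c) \ a).card := by
    rw [Finset.sum_comm]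
  rw [sum_meeting]
  simp only [sum_meeting a (fun c => q ^ ((_ ∪ c) \ a).card), Finset.sum_add_distrib]
  rw [e12', e12'']
  have hM : 0 ≤ ℓ * M := (Nat.cast_nonneg _).trans (h.card_meetingOnce_le ha)
  have hK := h.nonneg_of_mem ha
  set D := ℓ * M * q ^ (ℓ - 1) with hD
  have hD0 : 0 ≤ D := mul_nonneg hM (pow_nonneg hq0 _)
  have l1 : 4 * (ℓ : ℝ) ^ 8 * q ^ (ℓ - 1) ≤ L := by
    refine le_trans ?_ hL
    have := pow_le_pow_of_le_one hq0 (by linarith : q ≤ 1) (by omega : ℓ - 2 ≤ ℓ - 1)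
    gcongr
  have hℓ1 : (1 : ℝ) ≤ ℓ := by exact_mod_cast (by omega : 1 ≤ ℓ)
  have l2 : 4 * (ℓ : ℝ) ^ 4 * q ^ (ℓ - 2) ≤ L := by
    refine le_trans ?_ hL
    have : (ℓ : ℝ) ^ 4 ≤ ℓ ^ 8 := pow_le_pow_right₀ hℓ1 (by norm_num)
    gcongr
  have hL0 : 0 ≤ L := le_trans (by positivity) hL
  have e11' : D * (D + 4 * ℓ ^ 4 * q ^ (ℓ - 2) + (1 + K)) ≤ D * (D + L + (1 + K)) := by
    gcongr
  nlinarith [mul_nonneg hD0 hL0, mul_nonneg hD0 hK, mul_nonneg hK hL0, mul_nonneg hK hK,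
    mul_nonneg hL0 hL0]

end IsSparse

end TripleSum

/-! ### Counting arithmetic progressions and their overlaps -/

section ArithmeticProgressions

/-- The arithmetic progression `a, a + b, …, a + (ℓ - 1) b`. -/
def ap (ℓ a b : ℕ) : Finset ℕ := (Finset.range ℓ).image (fun i => a + i * b)

lemma mem_ap {ℓ a b x : ℕ} : x ∈ ap ℓ a b ↔ ∃ i < ℓ, a + i * b = x := by
  simp [ap]

lemma ap_injective {a b : ℕ} (hb : 0 < b) : Function.Injective (fun i => a + i * b) := by
  intro i j hij
  exact Nat.eq_of_mul_eq_mul_right hb (Nat.add_left_cancel hij)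

lemma card_ap {ℓ a b : ℕ} (hb : 0 < b) : (ap ℓ a b).card = ℓ := by
  rw [ap, Finset.card_image_of_injective _ (ap_injective hb), Finset.card_range]

lemma mem_apSet {ℓ n : ℕ} {T : Finset ℕ} :
    T ∈ apSet ℓ n ↔ T ⊆ Finset.Icc 1 n ∧ ∃ a b, 0 < b ∧ T = ap ℓ a b := by
  simp only [apSet, Finset.mem_filter, Finset.mem_powerset]
  rfl

lemma ap_subset_Icc_iff {ℓ n a b : ℕ} (hℓ : 1 ≤ ℓ) :
    ap ℓ a b ⊆ Finset.Icc 1 n ↔ 1 ≤ a ∧ a + (ℓ - 1) * b ≤ n := by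
  constructor
  · intro h
    have h1 := Finset.mem_Icc.1 (h (mem_ap.2 ⟨0, hℓ, rfl⟩))
    have h2 := Finset.mem_Icc.1 (h (mem_ap.2 ⟨ℓ - 1, by omega, rfl⟩))
    exact ⟨by simpa using h1.1, h2.2⟩
  · rintro ⟨h1, h2⟩ x hx
    obtain ⟨i, hi, rfl⟩ := mem_ap.1 hx
    have : i * b ≤ (ℓ - 1) * b := Nat.mul_le_mul_right b (by omega)
    exact Finset.mem_Icc.2 ⟨by omega, by omega⟩

/-- The minimum and the maximum of the set determine both parameters. -/
lemma ap_inj {ℓ a b a' b' : ℕ} (hℓ : 2 ≤ ℓ) (h : ap ℓ a b = ap ℓ a' b') : a = a' ∧ b = b' := by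
  have hmin : ∀ {a b a' b' : ℕ}, ap ℓ a b = ap ℓ a' b' → a' ≤ a := by
    intro a b a' b' h
    have : a ∈ ap ℓ a' b' := h ▸ mem_ap.2 ⟨0, by omega, by simp⟩
    obtain ⟨i, -, hi⟩ := mem_ap.1 this
    exact hi ▸ Nat.le_add_right _ _
  have hmax : ∀ {a b a' b' : ℕ}, ap ℓ a b = ap ℓ a' b' →
      a + (ℓ - 1) * b ≤ a' + (ℓ - 1) * b' := by
    intro a b a' b' h
    have : a + (ℓ - 1) * b ∈ ap ℓ a' b' := h ▸ mem_ap.2 ⟨ℓ - 1, by omega, rfl⟩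
    obtain ⟨i, hi, hi'⟩ := mem_ap.1 this
    rw [← hi']
    exact Nat.add_le_add_left (Nat.mul_le_mul_right _ (by omega)) _
  have ha : a = a' := le_antisymm (hmin h.symm) (hmin h)
  have hb := le_antisymm (hmax h) (hmax h.symm)
  subst ha
  exact ⟨rfl, Nat.eq_of_mul_eq_mul_left (by omega) (Nat.add_left_cancel hb)⟩

/-- A summand counts the first terms for difference `b`; truncated subtraction discards differences
that are too large. -/
lemma card_apSet {ℓ n : ℕ} (hℓ : 2 ≤ ℓ) :
    (apSet ℓ n).card = ∑ b ∈ Finset.Icc 1 n, (n - (ℓ - 1) * b) := by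
  have h1 : apSet ℓ n = ((Finset.Icc 1 n).sigma fun b => Finset.Icc 1 (n - (ℓ - 1) * b)).image
      (fun x => ap ℓ x.2 x.1) := by
    ext T
    rw [mem_apSet, Finset.mem_image]
    constructor
    · rintro ⟨hT, a, b, hb, rfl⟩
      rw [ap_subset_Icc_iff (by omega)] at hT
      refine ⟨⟨b, a⟩, ?_, rfl⟩
      have : 1 * b ≤ (ℓ - 1) * b := Nat.mul_le_mul_right b (by omega)
      simp only [Finset.mem_sigma, Finset.mem_Icc]
      omega
    · rintro ⟨⟨b, a⟩, hx, rfl⟩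
      simp only [Finset.mem_sigma, Finset.mem_Icc] at hx
      dsimp only
      rw [ap_subset_Icc_iff (by omega)]
      exact ⟨by omega, a, b, by omega, rfl⟩
  rw [h1, Finset.card_image_of_injective, Finset.card_sigma]
  · simp
  · rintro ⟨b, a⟩ ⟨b', a'⟩ h
    obtain ⟨rfl, rfl⟩ := ap_inj hℓ h
    rfl

/-- With `u = n - m * k`, the second expression is constant in `k` until truncation, while the first
only decreases. At truncation `0 ≤ u ≤ m`, so passing to `u = 0` preserves both bounds. -/
lemma two_mul_sum_Icc_sub_bounds (n m k : ℕ) :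
    2 * (m : ℤ) * ((∑ b ∈ Finset.Icc 1 k, (n - m * b) : ℕ) : ℤ) + ((n - m * k : ℕ) : ℤ) ^ 2 ≤ n ^ 2
      ∧ (n : ℤ) ^ 2 - m * n ≤ 2 * (m : ℤ) * ((∑ b ∈ Finset.Icc 1 k, (n - m * b) : ℕ) : ℤ)
        + ((n - m * k : ℕ) : ℤ) ^ 2 - m * ((n - m * k : ℕ) : ℤ) := by
  induction k with
  | zero => simp
  | succ k ih =>
    rw [Finset.sum_Icc_succ_top (by omega)]
    rcases le_total (m * (k + 1)) n with h | h
    · obtain ⟨u, hu⟩ := Nat.exists_eq_add_of_le h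
      have h1 : n - m * (k + 1) = u := by omega
      have h2 : n - m * k = u + m := by rw [Nat.mul_succ] at hu; omega
      rw [h1]
      rw [h2] at ih
      push_cast at ih ⊢
      constructor <;> nlinarith [ih.1, ih.2, sq_nonneg (m : ℤ)]
    · have h1 : n - m * (k + 1) = 0 := by omega
      have h2 : ((n - m * k : ℕ) : ℤ) ≤ m := by rw [Nat.mul_succ] at h; omega
      have h3 : 0 ≤ ((n - m * k : ℕ) : ℤ) := by positivity
      rw [h1]
      generalize ((n - m * k : ℕ) : ℤ) = u at *
      push_cast at ih ⊢
      constructor <;> nlinarith [ih.1, ih.2]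

lemma card_apSet_bounds {ℓ n : ℕ} (hℓ : 2 ≤ ℓ) :
    (n : ℝ) ^ 2 - (ℓ - 1) * n ≤ 2 * (ℓ - 1) * (apSet ℓ n).card
      ∧ 2 * ((ℓ : ℝ) - 1) * (apSet ℓ n).card ≤ n ^ 2 := by
  obtain ⟨m, rfl⟩ : ∃ m, ℓ = m + 1 := ⟨ℓ - 1, by omega⟩
  have h := two_mul_sum_Icc_sub_bounds n m n
  have h0 : n - m * n = 0 := Nat.sub_eq_zero_of_le (Nat.le_mul_of_pos_left n (by omega))
  have hc := card_apSet (ℓ := m + 1) (n := n) hℓ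
  rw [Nat.add_sub_cancel] at hc
  rw [h0, ← hc] at h
  obtain ⟨h1, h2⟩ := h
  simp only [Nat.cast_zero, ne_eq, OfNat.ofNat_ne_zero, not_false_eq_true, zero_pow, add_zero,
    mul_zero, sub_zero] at h1 h2
  push_cast
  rw [add_sub_cancel_right]
  exact ⟨by exact_mod_cast h2, by exact_mod_cast h1⟩

/-- A progression through `x` is fixed by the index of `x` and the difference, at most `n / (ℓ -
1)`; then `ℓ ≤ 2 * (ℓ - 1)`. -/
lemma card_apSet_mem_le {ℓ n : ℕ} (hℓ : 2 ≤ ℓ) (x : ℕ) :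
    ({T ∈ apSet ℓ n | x ∈ T} : Finset (Finset ℕ)).card ≤ 2 * n := by
  have hsub : ({T ∈ apSet ℓ n | x ∈ T} : Finset (Finset ℕ))
      ⊆ (Finset.range ℓ ×ˢ Finset.Icc 1 (n / (ℓ - 1))).image
        (fun y => ap ℓ (x - y.1 * y.2) y.2) := by
    intro T hT
    rw [Finset.mem_filter, mem_apSet] at hT
    obtain ⟨⟨hT, a, b, hb, rfl⟩, hx⟩ := hT
    obtain ⟨i, hi, rfl⟩ := mem_ap.1 hx
    rw [ap_subset_Icc_iff (by omega)] at hT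
    refine Finset.mem_image.2 ⟨(i, b), ?_, by simp⟩
    rw [Finset.mem_product, Finset.mem_range, Finset.mem_Icc, Nat.le_div_iff_mul_le (by omega),
      mul_comm b]
    exact ⟨hi, hb, by omega⟩
  calc _ ≤ _ := Finset.card_le_card hsub
    _ ≤ _ := Finset.card_image_le
    _ = ℓ * (n / (ℓ - 1)) := by rw [Finset.card_product, Finset.card_range, Nat.card_Icc]; simp
    _ ≤ 2 * (ℓ - 1) * (n / (ℓ - 1)) := Nat.mul_le_mul_right _ (by omega)
    _ = 2 * ((ℓ - 1) * (n / (ℓ - 1))) := by ring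
    _ ≤ 2 * n := Nat.mul_le_mul_left _ (Nat.mul_div_le _ _)

/-- The indices of `x` and `y` determine the progression: the difference is an exact quotient, taken
in `ℤ` because either point may come first. -/
lemma card_apSet_mem_mem_le {ℓ n x y : ℕ} (hxy : x ≠ y) :
    ({T ∈ apSet ℓ n | x ∈ T ∧ y ∈ T} : Finset (Finset ℕ)).card ≤ ℓ ^ 2 := by
  have hsub : ({T ∈ apSet ℓ n | x ∈ T ∧ y ∈ T} : Finset (Finset ℕ))
      ⊆ (Finset.range ℓ ×ˢ Finset.range ℓ).image
        (fun k => ap ℓ (x - k.1 * (((y : ℤ) - x) / (k.2 - k.1)).toNat)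
          (((y : ℤ) - x) / (k.2 - k.1)).toNat) := by
    intro T hT
    rw [Finset.mem_filter, mem_apSet] at hT
    obtain ⟨⟨-, a, b, hb, rfl⟩, hx, hy⟩ := hT
    obtain ⟨i, hi, rfl⟩ := mem_ap.1 hx
    obtain ⟨j, hj, rfl⟩ := mem_ap.1 hy
    refine Finset.mem_image.2 ⟨(i, j), by simp [hi, hj], ?_⟩
    have hij : (j : ℤ) - i ≠ 0 := by
      intro h
      have : i = j := by omega
      exact hxy (by rw [this])
    have h1 : (((a + j * b : ℕ) : ℤ) - (a + i * b : ℕ)) / (j - i) = b := by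
      have : ((a + j * b : ℕ) : ℤ) - (a + i * b : ℕ) = (j - i) * b := by push_cast; ring
      rw [this, Int.mul_ediv_cancel_left _ hij]
    simp only [h1, Int.toNat_natCast, Nat.add_sub_cancel]
  calc _ ≤ _ := Finset.card_le_card hsub
    _ ≤ _ := Finset.card_image_le
    _ = ℓ ^ 2 := by rw [Finset.card_product, Finset.card_range, sq]

/-- Consecutive terms of the finer progression are too close to lie both in the coarser one. -/
lemma two_mul_card_ap_inter_le_of_lt {ℓ a b a' b' : ℕ} (hb : 0 < b) (hlt : b < b') :
    2 * (ap ℓ a b ∩ ap ℓ a' b').card ≤ ℓ + 1 := by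
  have key : ∀ i, a + i * b ∈ ap ℓ a' b' → a + (i + 1) * b ∉ ap ℓ a' b' := by
    intro i hi hi'
    obtain ⟨j, -, hj⟩ := mem_ap.1 hi
    obtain ⟨j', -, hj'⟩ := mem_ap.1 hi'
    have h1 : j' * b' = j * b' + b := by rw [Nat.add_mul] at hj'; omega
    have h2 : j < j' := Nat.lt_of_mul_lt_mul_right (a := b') (by omega)
    have h3 : (j + 1) * b' ≤ j' * b' := Nat.mul_le_mul_right _ h2
    rw [Nat.add_mul] at h3
    omega
  set I := {i ∈ Finset.range ℓ | a + i * b ∈ ap ℓ a' b'} with hI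
  have h1 : (ap ℓ a b ∩ ap ℓ a' b').card ≤ I.card := by
    refine (Finset.card_le_card (fun x hx => ?_)).trans
      (Finset.card_image_le (s := I) (f := fun i => a + i * b))
    obtain ⟨hx, hx'⟩ := Finset.mem_inter.1 hx
    obtain ⟨i, hi, rfl⟩ := mem_ap.1 hx
    exact Finset.mem_image.2 ⟨i, Finset.mem_filter.2 ⟨Finset.mem_range.2 hi, hx'⟩, rfl⟩
  have h2 : I.card ≤ (Finset.range ((ℓ + 1) / 2)).card := by
    -- Halving is injective on a set of indices without two neighbours.
    refine Finset.card_le_card_of_injOn (fun i => i / 2) (fun i hi => ?_) ?_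
    · have := (Finset.mem_filter.1 hi).1
      rw [Finset.mem_range] at this
      simp only [Finset.coe_range, Set.mem_Iio]
      omega
    · intro i hi j hj hij
      have hi' := (Finset.mem_filter.1 hi).2
      have hj' := (Finset.mem_filter.1 hj).2
      simp only at hij
      by_contra hne
      rcases Nat.lt_or_gt_of_ne hne with h | h
      · have : j = i + 1 := by omega
        exact key i hi' (this ▸ hj')
      · have : i = j + 1 := by omega
        exact key j hj' (this ▸ hi')
  rw [Finset.card_range] at h2
  omega

lemma two_mul_card_ap_inter_le {ℓ a b a' b' : ℕ} (hb : 0 < b) (hb' : 0 < b') (hne : b ≠ b') :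
    2 * (ap ℓ a b ∩ ap ℓ a' b').card ≤ ℓ + 1 := by
  rcases Nat.lt_or_gt_of_ne hne with h | h
  · exact two_mul_card_ap_inter_le_of_lt hb h
  · rw [Finset.inter_comm]
    exact two_mul_card_ap_inter_le_of_lt hb' h

lemma le_card_ap_add_sdiff {ℓ a b k : ℕ} (hb : 0 < b) (hk : k ≤ ℓ) :
    k ≤ (ap ℓ (a + k * b) b \ ap ℓ a b).card := by
  calc k = ((Finset.Ico (ℓ - k) ℓ).image (fun i => (a + k * b) + i * b)).card := by
        rw [Finset.card_image_of_injective _ (ap_injective hb), Nat.card_Ico]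
        omega
    _ ≤ _ := Finset.card_le_card fun x hx => by
        obtain ⟨i, hi, rfl⟩ := Finset.mem_image.1 hx
        rw [Finset.mem_Ico] at hi
        refine Finset.mem_sdiff.2 ⟨mem_ap.2 ⟨i, hi.2, rfl⟩, fun h => ?_⟩
        obtain ⟨j, hj, hj'⟩ := mem_ap.1 h
        rw [add_assoc, ← add_mul] at hj'
        have := ap_injective hb hj'
        omega

lemma le_card_ap_sdiff_add {ℓ a b k : ℕ} (hb : 0 < b) (hk : k ≤ ℓ) :
    k ≤ (ap ℓ a b \ ap ℓ (a + k * b) b).card := by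
  calc k = ((Finset.range k).image (fun i => a + i * b)).card := by
        rw [Finset.card_image_of_injective _ (ap_injective hb), Finset.card_range]
    _ ≤ _ := Finset.card_le_card fun x hx => by
        obtain ⟨i, hi, rfl⟩ := Finset.mem_image.1 hx
        rw [Finset.mem_range] at hi
        refine Finset.mem_sdiff.2 ⟨mem_ap.2 ⟨i, by omega, rfl⟩, fun h => ?_⟩
        obtain ⟨j, hj, hj'⟩ := mem_ap.1 h
        rw [add_assoc, ← add_mul] at hj'
        have := ap_injective hb hj'
        omega

lemma eq_add_mul_of_not_disjoint_ap {ℓ a a' b : ℕ} (hb : 0 < b) (hle : a ≤ a')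
    (h : ¬ Disjoint (ap ℓ a b) (ap ℓ a' b)) : ∃ k < ℓ, a' = a + k * b := by
  obtain ⟨x, hx, hx'⟩ := Finset.not_disjoint_iff.1 h
  obtain ⟨i, hi, rfl⟩ := mem_ap.1 hx
  obtain ⟨j, hj, hj'⟩ := mem_ap.1 hx'
  have h1 : j * b ≤ i * b := by omega
  have h2 : j ≤ i := Nat.le_of_mul_le_mul_right h1 hb
  refine ⟨i - j, by omega, ?_⟩
  rw [Nat.sub_mul]
  omega

lemma sum_pow_pred_le {t : ℝ} (ht0 : 0 ≤ t) (ht : t ≤ 1 / 2) (m : ℕ) :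
    ∑ k ∈ Finset.Icc 1 m, t ^ (k - 1) ≤ 2 := by
  have h1 : ∑ k ∈ Finset.Icc 1 m, t ^ (k - 1) = ∑ k ∈ Finset.range m, t ^ k := by
    rw [Finset.range_eq_Ico, Finset.sum_Ico_eq_sum_range, ← Finset.Ico_add_one_right_eq_Icc,
      Finset.sum_Ico_eq_sum_range]
    simp
  have h2 := geom_sum_mul t m
  have h3 : 0 ≤ ∑ k ∈ Finset.range m, t ^ k := Finset.sum_nonneg fun _ _ => pow_nonneg ht0 _
  rw [h1]
  nlinarith [pow_nonneg ht0 m]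

lemma sum_image_pow_card_le {m : ℕ} {t : ℝ} (ht0 : 0 ≤ t) (ht : t ≤ 1 / 2) (T : Finset ℕ)
    (f : ℕ → Finset ℕ) (hf : ∀ k ∈ Finset.Icc 1 m, k ≤ (f k \ T).card) :
    ∑ c ∈ (Finset.Icc 1 m).image f, t ^ ((c \ T).card - 1) ≤ 2 := by
  refine le_trans ?_ (sum_pow_pred_le ht0 ht m)
  refine (Finset.sum_image_le_of_nonneg ?_).trans (Finset.sum_le_sum fun k hk => ?_)
  · exact fun _ _ => pow_nonneg ht0 _
  · exact pow_le_pow_of_le_one ht0 (by linarith) (Nat.sub_le_sub_right (hf k hk) 1)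

lemma exists_pow_mul_pow_le (k : ℕ) {r : ℝ} (hr0 : 0 ≤ r) (hr : r < 1) :
    ∃ C : ℝ, ∀ m : ℕ, (m : ℝ) ^ k * r ^ m ≤ C := by
  have h := tendsto_pow_const_mul_const_pow_of_abs_lt_one k (by rwa [abs_of_nonneg hr0] : |r| < 1)
  obtain ⟨C, hC⟩ := h.bddAbove_range
  exact ⟨C, fun m => hC ⟨m, rfl⟩⟩

lemma exists_pow_four_mul_le :
    ∃ C : ℝ, ∀ ℓ : ℕ, 3 ≤ ℓ → (ℓ : ℝ) ^ 4 * (1 / 2 : ℝ) ^ (ℓ / 2 - 1) ≤ C := by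
  obtain ⟨C, hC⟩ := exists_pow_mul_pow_le 4 (r := 1 / 2) (by norm_num) (by norm_num)
  refine ⟨162 * C, fun ℓ hℓ => ?_⟩
  have h1 : (ℓ : ℝ) ≤ 3 * ((ℓ / 2 : ℕ) : ℝ) := by exact_mod_cast (by omega : ℓ ≤ 3 * (ℓ / 2))
  have h2 : (1 / 2 : ℝ) ^ (ℓ / 2 - 1) = 2 * (1 / 2) ^ (ℓ / 2) := by
    obtain ⟨m, hm⟩ : ∃ m, ℓ / 2 = m + 1 := ⟨ℓ / 2 - 1, by omega⟩
    rw [hm, Nat.add_sub_cancel, pow_succ]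
    ring
  calc (ℓ : ℝ) ^ 4 * (1 / 2 : ℝ) ^ (ℓ / 2 - 1)
      ≤ (3 * ((ℓ / 2 : ℕ) : ℝ)) ^ 4 * (2 * (1 / 2) ^ (ℓ / 2)) := by rw [h2]; gcongr
    _ = 162 * (((ℓ / 2 : ℕ) : ℝ) ^ 4 * (1 / 2) ^ (ℓ / 2)) := by ring
    _ ≤ _ := by gcongr; exact hC _

/-- The point is that `K` depends on neither `ℓ` nor `n`. Shifts up and down contribute at most `2`
each, as a shift by `k` steps has at least `k` new points; for other differences, `ℓ ^ 4` sets of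
weight `2 ^ (1 - ℓ / 2)` stay bounded. -/
lemma exists_isSparse_apSet :
    ∃ K : ℝ, ∀ ℓ n : ℕ, 3 ≤ ℓ → IsSparse (apSet ℓ n) ℓ (2 * n) K := by
  obtain ⟨C, hC⟩ := exists_pow_four_mul_le
  refine ⟨2 + 2 + C, fun ℓ n hℓ => ?_⟩
  have hcard : ∀ T ∈ apSet ℓ n, T.card = ℓ := fun T hT => by
    obtain ⟨-, a, b, hb, rfl⟩ := mem_apSet.1 hT
    exact card_ap hb
  have hdeg : ∀ x, (({T ∈ apSet ℓ n | x ∈ T} : Finset (Finset ℕ)).card : ℝ) ≤ 2 * n := fun x => by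
    exact_mod_cast card_apSet_mem_le (by omega) x
  have hcod : ∀ x y, x ≠ y →
      ({T ∈ apSet ℓ n | x ∈ T ∧ y ∈ T} : Finset (Finset ℕ)).card ≤ ℓ ^ 2 := fun x y hxy =>
    card_apSet_mem_mem_le hxy
  refine ⟨hcard, hdeg, hcod, fun T hT t ht0 ht => ?_⟩
  obtain ⟨-, a, b, hb, rfl⟩ := mem_apSet.1 hT
  set G := meetingTwice (apSet ℓ n) (ap ℓ a b) with hG
  set U := (Finset.Icc 1 (ℓ - 1)).image (fun k => ap ℓ (a + k * b) b) with hU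
  -- The filter keeps the subtraction `a - k * b` from being truncated.
  set V := ((Finset.Icc 1 (ℓ - 1)).filter (fun k => k * b ≤ a)).image
    (fun k => ap ℓ (a - k * b) b) with hV
  set W := {c ∈ G | ℓ / 2 ≤ (c \ ap ℓ a b).card} with hW
  have hsub : G.erase (ap ℓ a b) ⊆ U ∪ V ∪ W := by
    intro c hc
    obtain ⟨hne, hcG⟩ := Finset.mem_erase.1 hc
    obtain ⟨hcF, hcard2⟩ := mem_meetingTwice.1 hcG
    have hdis : ¬ Disjoint (ap ℓ a b) c := not_disjoint_iff_card_inter_pos.2 (by omega)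
    obtain ⟨-, a', b', hb', rfl⟩ := mem_apSet.1 hcF
    rw [Finset.union_assoc, Finset.mem_union, Finset.mem_union]
    by_cases hbb : b = b'
    · subst hbb
      rcases le_total a a' with hle | hle
      · obtain ⟨k, hk, rfl⟩ := eq_add_mul_of_not_disjoint_ap hb hle hdis
        refine Or.inl (Finset.mem_image.2 ⟨k, Finset.mem_Icc.2 ⟨?_, by omega⟩, rfl⟩)
        rw [Nat.one_le_iff_ne_zero]
        rintro rfl
        exact hne (by simp)
      · obtain ⟨k, hk, rfl⟩ := eq_add_mul_of_not_disjoint_ap hb hle (fun h => hdis h.symm)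
        refine Or.inr (Or.inl (Finset.mem_image.2 ⟨k, Finset.mem_filter.2
          ⟨Finset.mem_Icc.2 ⟨?_, by omega⟩, by omega⟩, by simp⟩))
        rw [Nat.one_le_iff_ne_zero]
        rintro rfl
        exact hne (by simp)
    · refine Or.inr (Or.inr (Finset.mem_filter.2 ⟨hcG, ?_⟩))
      have h1 := two_mul_card_ap_inter_le (ℓ := ℓ) (a := a) (a' := a') hb hb' hbb
      have h2 := card_inter_add_card_sdiff (ap ℓ a b) (ap ℓ a' b')
      rw [card_ap hb'] at h2
      omega
  have hnn : ∀ c : Finset ℕ, 0 ≤ t ^ ((c \ ap ℓ a b).card - 1) := fun c => pow_nonneg ht0 _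
  have hUs : ∑ c ∈ U, t ^ ((c \ ap ℓ a b).card - 1) ≤ 2 :=
    sum_image_pow_card_le ht0 ht _ _ fun k hk =>
      le_card_ap_add_sdiff hb ((Finset.mem_Icc.1 hk).2.trans (Nat.sub_le _ _))
  have hVs : ∑ c ∈ V, t ^ ((c \ ap ℓ a b).card - 1) ≤ 2 := by
    refine le_trans ?_ (sum_pow_pred_le ht0 ht (ℓ - 1))
    refine (Finset.sum_image_le_of_nonneg fun _ _ => hnn _).trans ?_
    refine (Finset.sum_le_sum fun k hk => ?_).trans
      (Finset.sum_le_sum_of_subset_of_nonneg (Finset.filter_subset _ _)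
        fun _ _ _ => pow_nonneg ht0 _)
    obtain ⟨hk, hka⟩ := Finset.mem_filter.1 hk
    refine pow_le_pow_of_le_one ht0 (by linarith) (Nat.sub_le_sub_right ?_ 1)
    have := le_card_ap_sdiff_add (ℓ := ℓ) (a := a - k * b) (k := k) hb
      ((Finset.mem_Icc.1 hk).2.trans (Nat.sub_le _ _))
    rwa [Nat.sub_add_cancel hka] at this
  have hGcard : (G.card : ℝ) ≤ ℓ ^ 4 := by
    have h1 := card_meetingTwice_le hcod (ap ℓ a b)
    rw [card_ap hb] at h1
    calc (G.card : ℝ) ≤ ((ℓ ^ 2 * ℓ ^ 2 : ℕ) : ℝ) := by exact_mod_cast h1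
      _ = _ := by push_cast; ring
  have hWs : ∑ c ∈ W, t ^ ((c \ ap ℓ a b).card - 1) ≤ C := by
    calc _ ≤ ∑ _c ∈ W, (1 / 2 : ℝ) ^ (ℓ / 2 - 1) := by
          refine Finset.sum_le_sum fun c hc => ?_
          calc t ^ ((c \ ap ℓ a b).card - 1) ≤ t ^ (ℓ / 2 - 1) :=
                pow_le_pow_of_le_one ht0 (by linarith)
                  (Nat.sub_le_sub_right (Finset.mem_filter.1 hc).2 1)
            _ ≤ _ := by gcongr
      _ = W.card * (1 / 2 : ℝ) ^ (ℓ / 2 - 1) := by rw [Finset.sum_const, nsmul_eq_mul]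
      _ ≤ ℓ ^ 4 * (1 / 2 : ℝ) ^ (ℓ / 2 - 1) := by
          gcongr
          refine le_trans ?_ hGcard
          exact_mod_cast Finset.card_le_card (Finset.filter_subset _ _)
      _ ≤ C := hC ℓ hℓ
  have hunion : ∀ A B : Finset (Finset ℕ), ∑ c ∈ A ∪ B, t ^ ((c \ ap ℓ a b).card - 1)
      ≤ ∑ c ∈ A, t ^ ((c \ ap ℓ a b).card - 1) + ∑ c ∈ B, t ^ ((c \ ap ℓ a b).card - 1) := by
    intro A B
    rw [← Finset.sum_union_inter]
    exact le_add_of_nonneg_right (Finset.sum_nonneg fun _ _ => hnn _)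
  calc _ ≤ ∑ c ∈ U ∪ V ∪ W, t ^ ((c \ ap ℓ a b).card - 1) :=
        Finset.sum_le_sum_of_subset_of_nonneg hsub fun _ _ _ => hnn _
    _ ≤ _ := hunion _ _
    _ ≤ _ := add_le_add ((hunion _ _).trans (add_le_add hUs hVs)) hWs

end ArithmeticProgressions

/-! ### From characteristic functions to convergence in distribution -/

section Convergence

open Complex

variable {Ω : ℕ → Type*} [∀ n, MeasurableSpace (Ω n)] {P : ∀ n, Measure (Ω n)}
  [∀ n, IsProbabilityMeasure (P n)]

lemma charFun_map_eq_integral {Ω : Type*} [MeasurableSpace Ω] {P : Measure Ω} {X : Ω → ℝ}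
    (hX : AEMeasurable X P) (t : ℝ) :
    charFun (P.map X) t = ∫ ω, cexp ((t * X ω : ℝ) * I) ∂P := by
  rw [charFun_apply_real, integral_map hX]
  · push_cast; rfl
  · exact Continuous.aestronglyMeasurable (by fun_prop)

lemma tendstoInDistribution_gaussianReal {X : ∀ n, Ω n → ℝ} (hX : ∀ n, AEMeasurable (X n) (P n))
    (h : ∀ t : ℝ, Tendsto (fun n => ∫ ω, cexp ((t * X n ω : ℝ) * I) ∂(P n)) atTop
      (𝓝 (cexp (-(t ^ 2 / 2 : ℝ))))) :
    TendstoInDistribution X atTop (id : ℝ → ℝ) P (gaussianReal 0 1) where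
  forall_aemeasurable := hX
  tendsto := by
    refine ProbabilityMeasure.tendsto_iff_tendsto_charFun.2 fun t => ?_
    simp only [ProbabilityMeasure.coe_mk, Measure.map_id, charFun_gaussianReal]
    convert h t using 2
    · exact charFun_map_eq_integral (hX _) t
    · congr 1
      push_cast
      simp

/-- Lévy's continuity theorem is applied on `ℝ`. The result returns to `ℕ` because a bounded
continuous function on the closed subset `ℕ` extends to `ℝ`. -/
lemma tendstoInDistribution_poissonMeasure {r : NNReal} {X : ∀ n, Ω n → ℕ}
    (hX : ∀ n, AEMeasurable (X n) (P n))
    (h : ∀ t : ℝ, Tendsto (fun n => ∫ ω, cexp ((t * X n ω : ℝ) * I) ∂(P n)) atTop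
      (𝓝 (cexp (r * (cexp (t * I) - 1))))) :
    TendstoInDistribution X atTop (id : ℕ → ℕ) P (poissonMeasure r) where
  forall_aemeasurable := hX
  tendsto := by
    have hcast : Measurable (fun k : ℕ => (k : ℝ)) := measurable_of_countable _
    have hXr : ∀ n, AEMeasurable (fun ω => (X n ω : ℝ)) (P n) := fun n =>
      hcast.comp_aemeasurable (hX n)
    have hreal : Tendsto (β := ProbabilityMeasure ℝ)
        (fun n => ⟨(P n).map (fun ω => (X n ω : ℝ)), Measure.isProbabilityMeasure_map (hXr n)⟩)
        atTop (𝓝 ⟨(poissonMeasure r).map (fun k : ℕ => (k : ℝ)),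
          Measure.isProbabilityMeasure_map hcast.aemeasurable⟩) := by
      refine ProbabilityMeasure.tendsto_iff_tendsto_charFun.2 fun t => ?_
      simp only [ProbabilityMeasure.coe_mk]
      rw [charFun_map_cast_poissonMeasure]
      exact (h t).congr fun n => (charFun_map_eq_integral (hXr n) t).symm
    refine ProbabilityMeasure.tendsto_iff_forall_integral_tendsto.2 fun f => ?_
    obtain ⟨g, -, hg⟩ := BoundedContinuousFunction.exists_extension_norm_eq_of_isClosedEmbedding f
      Nat.isClosedEmbedding_coe_real
    have hgf : ∀ k : ℕ, g k = f k := fun k => congrFun hg k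
    have := ProbabilityMeasure.tendsto_iff_forall_integral_tendsto.1 hreal g
    simp only [ProbabilityMeasure.coe_mk, Measure.map_id] at this ⊢
    rw [integral_map hcast.aemeasurable g.continuous.aestronglyMeasurable] at this
    simp only [hgf] at this
    refine this.congr fun n => ?_
    rw [integral_map (hXr n) g.continuous.aestronglyMeasurable,
      integral_map (hX n) f.continuous.aestronglyMeasurable]
    simp only [hgf]

end Convergence

/-! ### The progression count as a sum of indicators -/

section Counting

lemma numAP_cast (ℓ n : ℕ) (S : Set ℕ) :
    (numAP ℓ n S : ℝ) = ∑ T ∈ apSet ℓ n, containsInd T S := by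
  rw [numAP, Nat.cast_sum]
  refine Finset.sum_congr rfl fun T _ => ?_
  split_ifs with h
  · rw [containsInd_of_subset h, Nat.cast_one]
  · rw [containsInd_of_not_subset h, Nat.cast_zero]

lemma measurable_numAP (ℓ n : ℕ) : Measurable (numAP ℓ n) := by
  have : numAP ℓ n = fun S => numAP ℓ n S := rfl
  rw [this]
  unfold numAP
  exact Finset.measurable_sum _ fun T _ =>
    Measurable.ite (measurableSet_superset T) measurable_const measurable_const

lemma subset_Icc_of_mem_apSet {ℓ n : ℕ} {T : Finset ℕ} (hT : T ∈ apSet ℓ n) :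
    T ⊆ Finset.Icc 1 n := (mem_apSet.1 hT).1

lemma card_of_mem_apSet {ℓ n : ℕ} {T : Finset ℕ} (hT : T ∈ apSet ℓ n) : T.card = ℓ := by
  obtain ⟨-, a, b, hb, rfl⟩ := mem_apSet.1 hT
  exact card_ap hb

end Counting

/-! ### Growth of the parameters and of the mean -/

section Asymptotics

lemma tendsto_zero_of_pow {y : ℕ → ℝ} (hy : ∀ᶠ n in atTop, 0 ≤ y n) {k : ℕ}
    (h : Tendsto (fun n => y n ^ k) atTop (𝓝 0)) : Tendsto y atTop (𝓝 0) := by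
  rw [Metric.tendsto_atTop'] at *
  intro ε hε
  obtain ⟨N, hN⟩ := h (ε ^ k) (pow_pos hε k)
  obtain ⟨N', hN'⟩ := eventually_atTop.1 hy
  refine ⟨max N N', fun n hn => ?_⟩
  have h0 := hN' n ((le_max_right _ _).trans hn.le)
  have h1 := hN n ((le_max_left _ _).trans_lt hn)
  rw [Real.dist_0_eq_abs, abs_of_nonneg (pow_nonneg h0 k)] at h1
  rw [Real.dist_0_eq_abs, abs_of_nonneg h0]
  exact lt_of_pow_lt_pow_left₀ k hε.le h1

variable {ℓ : ℕ → ℕ} {p : ℕ → unitInterval}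

lemma tendsto_pow_div_natCast_zero
    (hℓ : Tendsto (fun n : ℕ => (ℓ n : ℝ) / Real.log (n : ℝ)) atTop (𝓝 0)) (k : ℕ) :
    Tendsto (fun n : ℕ => (ℓ n : ℝ) ^ k / n) atTop (𝓝 0) := by
  have h1 : Tendsto (fun n : ℕ => Real.log n ^ k / (n : ℝ)) atTop (𝓝 0) :=
    (Real.isLittleO_pow_log_id_atTop (n := k)).tendsto_div_nhds_zero.comp
      tendsto_natCast_atTop_atTop
  refine squeeze_zero' (Eventually.of_forall fun n => by positivity) ?_ h1
  filter_upwards [hℓ.eventually_lt_const one_pos, eventually_gt_atTop 1] with n hn hn1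
  have hlog : 0 < Real.log n := Real.log_pos (by exact_mod_cast hn1)
  rw [div_lt_one hlog] at hn
  gcongr

/-- If `n² pˡ` stays away from zero, then `n p` grows faster than every power of `ℓ`. -/
lemma tendsto_sq_div_mul_zero (h3 : ∀ᶠ n in atTop, 3 ≤ ℓ n)
    (hℓ : Tendsto (fun n : ℕ => (ℓ n : ℝ) / Real.log (n : ℝ)) atTop (𝓝 0))
    (hp_pos : ∀ n, 0 < p n) {c : ℝ} (hc : 0 < c)
    (h : ∀ᶠ n : ℕ in atTop, c ≤ (n : ℝ) ^ 2 * (p n : ℝ) ^ ℓ n) :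
    Tendsto (fun n : ℕ => (ℓ n : ℝ) ^ 2 / (n * p n)) atTop (𝓝 0) := by
  have hp0 : ∀ n, (0 : ℝ) < p n := hp_pos
  -- Cubing is enough: `p ^ ℓ ≤ p ^ 3` gives `(n p) ^ 3 ≥ c n`, and `ℓ ^ 6 / n → 0`.
  refine tendsto_zero_of_pow (k := 3) (Eventually.of_forall fun n => ?_) ?_
  · have := (hp0 n).le
    positivity
  have h6 := (tendsto_pow_div_natCast_zero hℓ 6).const_mul c⁻¹
  rw [mul_zero] at h6
  refine squeeze_zero' (Eventually.of_forall fun n => ?_) ?_ h6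
  · have := (hp0 n).le
    positivity
  filter_upwards [h3, h, eventually_gt_atTop 0] with n hn3 hn hn0
  have hn0' : (0 : ℝ) < n := by exact_mod_cast hn0
  have hpn := hp0 n
  have h1 : (p n : ℝ) ^ ℓ n ≤ (p n : ℝ) ^ 3 := pow_le_pow_of_le_one hpn.le (p n).2.2 hn3
  have h2 : c * n ≤ (n * p n : ℝ) ^ 3 := by
    calc c * n ≤ (n : ℝ) ^ 2 * (p n : ℝ) ^ ℓ n * n := by gcongr
      _ ≤ (n : ℝ) ^ 2 * (p n : ℝ) ^ 3 * n := by gcongr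
      _ = _ := by ring
  calc ((ℓ n : ℝ) ^ 2 / (n * p n)) ^ 3 = (ℓ n : ℝ) ^ 6 / (n * p n) ^ 3 := by
        rw [div_pow]; ring
    _ ≤ (ℓ n : ℝ) ^ 6 / (c * n) := by gcongr
    _ = _ := by field_simp

lemma expected_bounds {ℓ n : ℕ} (hℓ : 2 ≤ ℓ) (hn : 0 < n) {q : ℝ} (hq : 0 ≤ q) :
    (n : ℝ) ^ 2 * q ^ ℓ / ((ℓ : ℝ) - 1) * (1 - ℓ / n) ≤ 2 * ((apSet ℓ n).card * q ^ ℓ)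
      ∧ 2 * ((apSet ℓ n).card * q ^ ℓ) ≤ (n : ℝ) ^ 2 * q ^ ℓ / ((ℓ : ℝ) - 1) := by
  obtain ⟨h1, h2⟩ := card_apSet_bounds (n := n) hℓ
  have hm : (0 : ℝ) < ℓ - 1 := by
    have : (2 : ℝ) ≤ ℓ := by exact_mod_cast hℓ
    linarith
  have hn' : (0 : ℝ) < n := by exact_mod_cast hn
  have hqp := pow_nonneg hq ℓ
  constructor
  · rw [div_mul_eq_mul_div, div_le_iff₀ hm]
    have : (n : ℝ) ^ 2 * q ^ ℓ * (1 - ℓ / n) = (n ^ 2 - ℓ * n) * q ^ ℓ := by field_simp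
    rw [this]
    nlinarith [mul_nonneg hqp hn'.le]
  · rw [le_div_iff₀ hm]
    nlinarith

lemma tendsto_card_mul_pow (h3 : ∀ᶠ n in atTop, 3 ≤ ℓ n)
    (hℓ : Tendsto (fun n : ℕ => (ℓ n : ℝ) / Real.log (n : ℝ)) atTop (𝓝 0)) {c : ℝ}
    (h : Tendsto (fun n : ℕ => (n : ℝ) ^ 2 * (p n : ℝ) ^ ℓ n / ((ℓ n : ℝ) - 1)) atTop (𝓝 c)) :
    Tendsto (fun n : ℕ => (apSet (ℓ n) n).card * (p n : ℝ) ^ ℓ n) atTop (𝓝 (c / 2)) := by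
  have h1 := (tendsto_pow_div_natCast_zero hℓ 1)
  simp only [pow_one] at h1
  have h2 := h.mul (h1.const_sub 1)
  rw [sub_zero, mul_one] at h2
  have h4 : Tendsto (fun n : ℕ => 2 * ((apSet (ℓ n) n).card * (p n : ℝ) ^ ℓ n)) atTop (𝓝 c) := by
    refine tendsto_of_tendsto_of_tendsto_of_le_of_le' h2 h ?_ ?_
    · filter_upwards [h3, eventually_gt_atTop 0] with n hn hn0
      exact (expected_bounds (by omega) hn0 (p n).2.1).1
    · filter_upwards [h3, eventually_gt_atTop 0] with n hn hn0
      exact (expected_bounds (by omega) hn0 (p n).2.1).2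
  refine (h4.div_const 2).congr fun n => by ring

end Asymptotics

/-! ### The Poisson limit -/

section PoissonRegime

open Complex

variable {ℓ : ℕ → ℕ} {p : ℕ → unitInterval}

/-- The once-meeting weight appears twice: it bounds part of the joint probabilities and all the
products of means. -/
lemma norm_integral_numAP_sub_poisson_le {K : ℝ} {ℓ n : ℕ} {p : unitInterval} (hℓ : 3 ≤ ℓ)
    (hs : IsSparse (apSet ℓ n) ℓ (2 * n) K) (hp : (p : ℝ) ≤ 1 / 2) (t : ℝ) :
    ‖(∫ S, cexp ((t * numAP ℓ n S : ℝ) * I) ∂(randomSubset n p))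
        - cexp (((apSet ℓ n).card * (p : ℝ) ^ ℓ : ℝ) * (cexp (t * I) - 1))‖
      ≤ t ^ 2 * Real.exp (2 * ((apSet ℓ n).card * (p : ℝ) ^ ℓ))
        * ((apSet ℓ n).card * (p : ℝ) ^ ℓ * (2 * (ℓ * (2 * n) * (p : ℝ) ^ (ℓ - 1)) + p * K)) := by
  simp only [numAP_cast]
  refine (norm_integral_sub_poisson_le (fun _ => subset_Icc_of_mem_apSet)
    (fun _ => card_of_mem_apSet) (by omega) t).trans ?_
  have hp0 : (0 : ℝ) ≤ p := p.2.1
  gcongr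
  have h1 : ∑ a ∈ apSet ℓ n, ∑ b ∈ (meeting (apSet ℓ n) a).erase a, (p : ℝ) ^ (a ∪ b).card
      ≤ (apSet ℓ n).card * ((p : ℝ) ^ ℓ * (ℓ * (2 * n) * (p : ℝ) ^ (ℓ - 1) + p * K)) := by
    rw [← nsmul_eq_mul, ← Finset.sum_const]
    exact Finset.sum_le_sum fun a ha => hs.sum_erase_meeting_pow_le (by omega) ha hp0 hp
  have h2 : ∑ a ∈ apSet ℓ n, ∑ _b ∈ meeting (apSet ℓ n) a, (p : ℝ) ^ ℓ * (p : ℝ) ^ ℓ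
      ≤ (apSet ℓ n).card * ((p : ℝ) ^ ℓ * (ℓ * (2 * n) * (p : ℝ) ^ (ℓ - 1))) := by
    rw [← nsmul_eq_mul, ← Finset.sum_const]
    refine Finset.sum_le_sum fun a ha => ?_
    rw [Finset.sum_const, nsmul_eq_mul]
    have h3 := hs.card_meeting_le a
    rw [card_of_mem_apSet ha] at h3
    have h4 : (p : ℝ) ^ ℓ ≤ (p : ℝ) ^ (ℓ - 1) := pow_le_pow_of_le_one hp0 p.2.2 (by omega)
    calc _ ≤ (ℓ * (2 * n) : ℝ) * ((p : ℝ) ^ ℓ * (p : ℝ) ^ (ℓ - 1)) := by gcongr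
      _ = _ := by ring
  linarith

lemma tendsto_integral_numAP_poisson (h3 : ∀ᶠ n in atTop, 3 ≤ ℓ n)
    (hℓ : Tendsto (fun n : ℕ => (ℓ n : ℝ) / Real.log (n : ℝ)) atTop (𝓝 0))
    (hp_pos : ∀ n, 0 < p n) (hp : Tendsto (fun n : ℕ => (p n : ℝ)) atTop (𝓝 0)) {c : ℝ}
    (hc : 0 ≤ c)
    (h : Tendsto (fun n : ℕ => (n : ℝ) ^ 2 * (p n : ℝ) ^ ℓ n / ((ℓ n : ℝ) - 1)) atTop (𝓝 c))
    (t : ℝ) :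
    Tendsto (fun n => ∫ S, cexp ((t * numAP (ℓ n) n S : ℝ) * I) ∂(randomSubset n (p n))) atTop
      (𝓝 (cexp ((c / 2 : ℝ) * (cexp (t * I) - 1)))) := by
  have hp0 : ∀ n, (0 : ℝ) < p n := hp_pos
  have hμ := tendsto_card_mul_pow h3 hℓ h
  -- For `c = 0` there is no lower bound on `n ^ 2 p ^ ℓ`, hence no control of `n p`; but the mean
  -- tends to `0`, which suffices.
  rcases hc.eq_or_lt with rfl | hc
  · rw [zero_div] at hμ
    simp only [zero_div, ofReal_zero, zero_mul, Complex.exp_zero]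
    rw [tendsto_iff_norm_sub_tendsto_zero]
    have h0 := hμ.const_mul |t|
    rw [mul_zero] at h0
    refine squeeze_zero (fun n => norm_nonneg _) (fun n => ?_) h0
    have := norm_integral_mul_cexp_sub_le (integrable_randomSubset (n := n) (p := p n))
      (fun _ => 1) (fun S => (numAP (ℓ n) n S : ℝ)) (fun _ => 0) t
    simp only [ofReal_one, one_mul, mul_zero, ofReal_zero, zero_mul, Complex.exp_zero,
      integral_const, probReal_univ, one_smul, abs_one, sub_zero, Nat.abs_cast] at this
    refine this.trans_eq ?_
    simp only [numAP_cast]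
    rw [integral_sum_containsInd (fun _ => subset_Icc_of_mem_apSet) (fun _ => card_of_mem_apSet)]
  · have hnp := tendsto_sq_div_mul_zero h3 hℓ hp_pos (half_pos hc) (by
      filter_upwards [h3, h.eventually_const_lt (half_lt_self hc)] with n hn hn'
      have hm : (1 : ℝ) ≤ ℓ n - 1 := by
        have : (3 : ℝ) ≤ ℓ n := by exact_mod_cast hn
        linarith
      rw [lt_div_iff₀ (by linarith)] at hn'
      nlinarith)
    -- This weight is at most `2 * (n ^ 2 p ^ ℓ / (ℓ - 1)) * (ℓ ^ 2 / (n p))`, a convergent factor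
    -- times a vanishing one.
    have hD : Tendsto (fun n : ℕ => (ℓ n * (2 * n) * (p n : ℝ) ^ (ℓ n - 1) : ℝ)) atTop (𝓝 0) := by
      have h1 := (h.mul hnp).const_mul 2
      rw [mul_zero, mul_zero] at h1
      refine squeeze_zero' (Eventually.of_forall fun n => ?_) ?_ h1
      · have := (hp0 n).le
        positivity
      filter_upwards [h3, eventually_gt_atTop 0] with n hn hn0
      have hn0' : (0 : ℝ) < n := by exact_mod_cast hn0
      have hl : (3 : ℝ) ≤ ℓ n := by exact_mod_cast hn
      have hpn := hp0 n
      obtain ⟨m, hm⟩ : ∃ m, ℓ n = m + 1 := ⟨ℓ n - 1, by omega⟩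
      have e : 2 * ((n : ℝ) ^ 2 * (p n : ℝ) ^ ℓ n / ((ℓ n : ℝ) - 1) * ((ℓ n : ℝ) ^ 2 / (n * p n)))
          = ℓ n * (2 * n) * (p n : ℝ) ^ (ℓ n - 1) * (ℓ n / (ℓ n - 1)) := by
        have h5 : (ℓ n : ℝ) - 1 ≠ 0 := by linarith
        have h6 : (p n : ℝ) ^ ℓ n = (p n : ℝ) ^ (ℓ n - 1) * p n := by
          rw [← pow_succ, Nat.sub_add_cancel (by omega)]
        rw [h6]
        field_simp
      rw [e]
      refine le_mul_of_one_le_right (by positivity) ?_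
      rw [one_le_div (by linarith)]
      linarith
    obtain ⟨K, hK⟩ := exists_isSparse_apSet
    have hbound : Tendsto (fun n : ℕ => t ^ 2
        * Real.exp (2 * ((apSet (ℓ n) n).card * (p n : ℝ) ^ ℓ n))
        * ((apSet (ℓ n) n).card * (p n : ℝ) ^ ℓ n
          * (2 * (ℓ n * (2 * n) * (p n : ℝ) ^ (ℓ n - 1)) + p n * K))) atTop (𝓝 0) := by
      have h1 := ((Real.continuous_exp.tendsto _).comp (hμ.const_mul 2)).const_mul (t ^ 2)
      have h2 := hμ.mul ((hD.const_mul 2).add (hp.mul_const K))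
      have h4 := h1.mul h2
      simpa using h4
    have hlim : Tendsto (fun n : ℕ => cexp (((apSet (ℓ n) n).card * (p n : ℝ) ^ ℓ n : ℝ)
        * (cexp (t * I) - 1))) atTop (𝓝 (cexp ((c / 2 : ℝ) * (cexp (t * I) - 1)))) :=
      (Complex.continuous_exp.tendsto _).comp
        (((continuous_ofReal.tendsto _).comp hμ).mul_const _)
    refine tendsto_of_tendsto_of_dist hlim ?_
    refine squeeze_zero' (Eventually.of_forall fun n => dist_nonneg) ?_ hbound
    filter_upwards [h3, hp.eventually_lt_const (by norm_num : (0 : ℝ) < 1 / 2)] with n hn hn'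
    rw [dist_comm, dist_eq_norm]
    exact norm_integral_numAP_sub_poisson_le hn (hK _ _ hn) hn'.le t

end PoissonRegime

/-! ### The normal limit -/

section NormalRegime

open Complex

variable {ℓ : ℕ → ℕ} {p : ℕ → unitInterval}

/-- The variance of the number of `ℓ`-term progressions in `[n]_p`. -/
noncomputable def varAP (ℓ n : ℕ) (p : unitInterval) : ℝ :=
  variance (fun S => (numAP ℓ n S : ℝ)) (randomSubset n p)

lemma half_card_mul_pow_le_varAP {ℓ n : ℕ} {p : unitInterval} (hℓ : 1 ≤ ℓ)
    (hp : (p : ℝ) ≤ 1 / 2) : (apSet ℓ n).card * (p : ℝ) ^ ℓ / 2 ≤ varAP ℓ n p := by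
  simp only [varAP, numAP_cast]
  refine le_trans ?_ (card_mul_le_variance (p := p) (fun _ => subset_Icc_of_mem_apSet)
    (fun _ => card_of_mem_apSet))
  have h0 : (0 : ℝ) ≤ (p : ℝ) ^ ℓ := pow_nonneg p.2.1 _
  have h1 : (p : ℝ) ^ ℓ ≤ 1 / 2 := (pow_le_of_le_one p.2.1 p.2.2 (by omega)).trans hp
  have h2 : 0 ≤ ((apSet ℓ n).card : ℝ) * (p : ℝ) ^ ℓ := by positivity
  nlinarith

/-- When `2 * ℓ ≤ n` there are at least `n ^ 2 / 4` incidences between points and progressions; the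
degree bound on the variance then gives `1 / 32 = (1 / 2) * (1 / 4) ^ 2`. -/
lemma pow_mul_cube_le_varAP {ℓ n : ℕ} {p : unitInterval} (hℓ : 2 ≤ ℓ) (hn : 0 < n)
    (hℓn : 2 * ℓ ≤ n) (hp0 : 0 < p) (hp : (p : ℝ) ≤ 1 / 2) :
    (n : ℝ) ^ 3 * (p : ℝ) ^ (2 * ℓ - 1) / 32 ≤ varAP ℓ n p := by
  simp only [varAP, numAP_cast]
  have h := pow_mul_sq_card_mul_le_variance (n := n) (p := p)
    (fun _ => subset_Icc_of_mem_apSet) (fun _ => card_of_mem_apSet) (by omega : 0 < ℓ) hp0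
  have hn' : (0 : ℝ) < n := by exact_mod_cast hn
  have hℓn' : 2 * (ℓ : ℝ) ≤ n := by exact_mod_cast hℓn
  have hc : (n : ℝ) ^ 2 / 4 ≤ ((apSet ℓ n).card * ℓ : ℕ) := by
    have := (card_apSet_bounds (n := n) hℓ).1
    push_cast
    have h0 : (0 : ℝ) ≤ (apSet ℓ n).card := Nat.cast_nonneg _
    nlinarith
  have hp1 : 0 ≤ (p : ℝ) ^ (2 * ℓ - 1) := pow_nonneg p.2.1 _
  refine le_of_mul_le_mul_left (le_trans ?_ h) hn'
  calc (n : ℝ) * (n ^ 3 * (p : ℝ) ^ (2 * ℓ - 1) / 32)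
      = (p : ℝ) ^ (2 * ℓ - 1) * (1 / 2) * (n ^ 2 / 4) ^ 2 := by ring
    _ ≤ _ := by
      have : (1 / 2 : ℝ) ≤ 1 - p := by linarith
      have : 0 ≤ (p : ℝ) ^ (2 * ℓ - 1) * (1 - p) := mul_nonneg hp1 (by linarith)
      gcongr

/-- Squared to avoid half-integral powers, and arranged to be compared with the cube of the bound in
`pow_mul_cube_le_varAP`. -/
lemma card_mul_pow_mul_sq_le {ℓ n : ℕ} {q : ℝ} (hℓ : 2 ≤ ℓ) (hq : 0 < q) :
    ((apSet ℓ n).card * q ^ ℓ * (ℓ * (2 * n) * q ^ (ℓ - 1)) ^ 2) ^ 2 * (n * q)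
      ≤ 16 * ℓ ^ 2 * (n ^ 3 * q ^ (2 * ℓ - 1)) ^ 3 := by
  obtain ⟨m, rfl⟩ : ∃ m, ℓ = m + 1 := ⟨ℓ - 1, by omega⟩
  have hc : ((apSet (m + 1) n).card : ℝ) * (m + 1 : ℕ) ≤ n ^ 2 := by
    have := (card_apSet_bounds (n := n) hℓ).2
    have h0 : (0 : ℝ) ≤ (apSet (m + 1) n).card := Nat.cast_nonneg _
    have h1 : (2 : ℝ) ≤ (m + 1 : ℕ) := by exact_mod_cast hℓ
    nlinarith
  have e1 : m + 1 - 1 = m := by omega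
  have e2 : 2 * (m + 1) - 1 = 2 * m + 1 := by omega
  rw [e1, e2]
  calc _ = (((apSet (m + 1) n).card : ℝ) * (m + 1 : ℕ)) ^ 2
        * (16 * (m + 1 : ℕ) ^ 2 * n ^ 5 * q ^ (6 * m + 3)) := by ring
    _ ≤ (n ^ 2) ^ 2 * (16 * (m + 1 : ℕ) ^ 2 * n ^ 5 * q ^ (6 * m + 3)) := by gcongr
    _ = _ := by ring

lemma tendsto_card_mul_pow_atTop (h3 : ∀ᶠ n in atTop, 3 ≤ ℓ n)
    (hℓ : Tendsto (fun n : ℕ => (ℓ n : ℝ) / Real.log (n : ℝ)) atTop (𝓝 0))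
    (h : Tendsto (fun n : ℕ => (n : ℝ) ^ 2 * (p n : ℝ) ^ ℓ n / ((ℓ n : ℝ) - 1)) atTop atTop) :
    Tendsto (fun n : ℕ => (apSet (ℓ n) n).card * (p n : ℝ) ^ ℓ n) atTop atTop := by
  have h1 := tendsto_pow_div_natCast_zero hℓ 1
  simp only [pow_one] at h1
  refine tendsto_atTop_mono' _ ?_ (h.atTop_div_const (by norm_num : (0 : ℝ) < 4))
  filter_upwards [h3, eventually_gt_atTop 0, h.eventually_ge_atTop 0,
    h1.eventually_lt_const (by norm_num : (0 : ℝ) < 1 / 2)] with n hn hn0 hx hl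
  have := (expected_bounds (n := n) (by omega : 2 ≤ ℓ n) hn0 (p n).2.1).1
  nlinarith

/-- Since `(D + C) ^ 2 ≤ 2 D ^ 2 + 2 C ^ 2`, the two parts can be handled by different variance
bounds: `t1` uses the diagonal one, `t2` the degree one. -/
lemma tendsto_tripleSum_div (h3 : ∀ᶠ n in atTop, 3 ≤ ℓ n)
    (hℓ : Tendsto (fun n : ℕ => (ℓ n : ℝ) / Real.log (n : ℝ)) atTop (𝓝 0))
    (hp_pos : ∀ n, 0 < p n) (hp : Tendsto (fun n : ℕ => (p n : ℝ)) atTop (𝓝 0))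
    (h : Tendsto (fun n : ℕ => (n : ℝ) ^ 2 * (p n : ℝ) ^ ℓ n / ((ℓ n : ℝ) - 1)) atTop atTop) :
    Tendsto (fun n => tripleSum (apSet (ℓ n) n) (p n) / √(varAP (ℓ n) n (p n)) ^ 3) atTop
      (𝓝 0) := by
  have hp0 : ∀ n, (0 : ℝ) < p n := hp_pos
  have hμ := tendsto_card_mul_pow_atTop h3 hℓ h
  set μ : ℕ → ℝ := fun n => (apSet (ℓ n) n).card * (p n : ℝ) ^ ℓ n with hμdef
  set D : ℕ → ℝ := fun n => ℓ n * (2 * n) * (p n : ℝ) ^ (ℓ n - 1) with hD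
  set V : ℕ → ℝ := fun n => varAP (ℓ n) n (p n) with hV
  have hphalf := hp.eventually_lt_const (by norm_num : (0 : ℝ) < 1 / 2)
  have hμpos : ∀ᶠ n in atTop, 0 < μ n := hμ.eventually_gt_atTop 0
  have hVμ : ∀ᶠ n in atTop, μ n / 2 ≤ V n := by
    filter_upwards [h3, hphalf] with n hn hpn
    exact half_card_mul_pow_le_varAP (by omega) hpn.le
  have hVpos : ∀ᶠ n in atTop, 0 < V n := by
    filter_upwards [hμpos, hVμ] with n h1 h2
    linarith
  have hnp := tendsto_sq_div_mul_zero h3 hℓ hp_pos one_pos (by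
    filter_upwards [h3, h.eventually_ge_atTop 1] with n hn hn'
    have hm : (2 : ℝ) ≤ ℓ n - 1 := by
      have : (3 : ℝ) ≤ ℓ n := by exact_mod_cast hn
      linarith
    rw [le_div_iff₀ (by linarith)] at hn'
    linarith)
  have hsq : ∀ x y : ℝ, 0 ≤ y → (x / √y ^ 3) ^ 2 = x ^ 2 / y ^ 3 := fun x y hy => by
    rw [div_pow, ← pow_mul, mul_comm 3, pow_mul, Real.sq_sqrt hy]
  have t1 : Tendsto (fun n => μ n / √(V n) ^ 3) atTop (𝓝 0) := by
    refine tendsto_zero_of_pow (k := 2) ?_ ?_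
    · filter_upwards [hμpos] with n hn
      positivity
    have h8 := hμ.inv_tendsto_atTop.const_mul 8
    rw [mul_zero] at h8
    refine squeeze_zero' (Eventually.of_forall fun n => sq_nonneg _) ?_ h8
    filter_upwards [hμpos, hVμ, hVpos] with n h1 h2 h4
    rw [hsq _ _ h4.le]
    calc μ n ^ 2 / V n ^ 3 ≤ μ n ^ 2 / (μ n / 2) ^ 3 := by gcongr
      _ = 8 * (μ n)⁻¹ := by field_simp; norm_num
  have t2 : Tendsto (fun n => μ n * D n ^ 2 / √(V n) ^ 3) atTop (𝓝 0) := by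
    refine tendsto_zero_of_pow (k := 2) ?_ ?_
    · filter_upwards [hμpos] with n hn
      positivity
    have h8 := hnp.const_mul (16 * 32 ^ 3)
    rw [mul_zero] at h8
    refine squeeze_zero' (Eventually.of_forall fun n => sq_nonneg _) ?_ h8
    have h1 := tendsto_pow_div_natCast_zero hℓ 1
    simp only [pow_one] at h1
    filter_upwards [h3, hphalf, eventually_gt_atTop 0, hVpos,
      h1.eventually_lt_const (by norm_num : (0 : ℝ) < 1 / 2)] with n hn hpn hn0 hVn hln
    have hn0' : (0 : ℝ) < n := by exact_mod_cast hn0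
    have hpn0 := hp0 n
    rw [div_lt_iff₀ hn0'] at hln
    have hln' : 2 * ℓ n ≤ n := by
      have : 2 * (ℓ n : ℝ) ≤ n := by linarith
      exact_mod_cast this
    have e1 := pow_mul_cube_le_varAP (by omega : 2 ≤ ℓ n) hn0 hln' (hp_pos n) hpn.le
    have e2 := card_mul_pow_mul_sq_le (n := n) (by omega : 2 ≤ ℓ n) hpn0
    rw [hsq _ _ hVn.le, div_le_iff₀ (by positivity)]
    have e3 : ((n : ℝ) ^ 3 * (p n : ℝ) ^ (2 * ℓ n - 1)) ^ 3 ≤ 32 ^ 3 * V n ^ 3 := by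
      rw [← mul_pow]
      exact pow_le_pow_left₀ (by positivity) (by linarith) 3
    calc (μ n * D n ^ 2) ^ 2 = (μ n * D n ^ 2) ^ 2 * (n * p n) / (n * p n) := by field_simp
      _ ≤ 16 * (ℓ n : ℝ) ^ 2 * (32 ^ 3 * V n ^ 3) / (n * p n) := by
          refine div_le_div_of_nonneg_right (e2.trans ?_) (by positivity)
          gcongr
      _ = _ := by ring
  obtain ⟨K, hK⟩ := exists_isSparse_apSet
  obtain ⟨L, hL⟩ := exists_pow_mul_pow_le 8 (r := 1 / 4) (by norm_num) (by norm_num)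
  set C := 2 + 2 * K + 64 * L with hC
  have t3 := (t2.const_mul 2).add (t1.const_mul (2 * C ^ 2))
  rw [mul_zero, mul_zero, add_zero] at t3
  refine squeeze_zero' (Eventually.of_forall fun n => ?_) ?_ t3
  · have : 0 ≤ tripleSum (apSet (ℓ n) n) (p n) := Finset.sum_nonneg fun a _ =>
      Finset.sum_nonneg fun b _ => Finset.sum_nonneg fun c _ => pow_nonneg (p n).2.1 _
    positivity
  filter_upwards [h3, hp.eventually_lt_const (by norm_num : (0 : ℝ) < 1 / 4), hμpos]
    with n hn hpn hμn
  have hpn0 := hp0 n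
  have hL' : 4 * (ℓ n : ℝ) ^ 8 * (p n : ℝ) ^ (ℓ n - 2) ≤ 64 * L := by
    have e : (1 / 4 : ℝ) ^ (ℓ n) = (1 / 4) ^ (ℓ n - 2) * (1 / 16) := by
      obtain ⟨m, hm⟩ : ∃ m, ℓ n = m + 2 := ⟨ℓ n - 2, by omega⟩
      rw [hm, Nat.add_sub_cancel]
      ring
    calc 4 * (ℓ n : ℝ) ^ 8 * (p n : ℝ) ^ (ℓ n - 2)
        ≤ 4 * (ℓ n : ℝ) ^ 8 * (1 / 4 : ℝ) ^ (ℓ n - 2) := by gcongr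
      _ = 64 * ((ℓ n : ℝ) ^ 8 * (1 / 4 : ℝ) ^ (ℓ n)) := by rw [e]; ring
      _ ≤ _ := by gcongr; exact hL _
  have hts := (hK (ℓ n) n hn).tripleSum_le (by omega) hpn0.le hpn.le hL'
  calc tripleSum (apSet (ℓ n) n) (p n) / √(V n) ^ 3
      ≤ μ n * (D n + C) ^ 2 / √(V n) ^ 3 := by gcongr
    _ ≤ μ n * (2 * D n ^ 2 + 2 * C ^ 2) / √(V n) ^ 3 := by
        gcongr
        nlinarith [sq_nonneg (D n - C)]
    _ = _ := by ring

lemma tendsto_integral_numAP_gaussian (h3 : ∀ᶠ n in atTop, 3 ≤ ℓ n)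
    (hℓ : Tendsto (fun n : ℕ => (ℓ n : ℝ) / Real.log (n : ℝ)) atTop (𝓝 0))
    (hp_pos : ∀ n, 0 < p n) (hp : Tendsto (fun n : ℕ => (p n : ℝ)) atTop (𝓝 0))
    (h : Tendsto (fun n : ℕ => (n : ℝ) ^ 2 * (p n : ℝ) ^ ℓ n / ((ℓ n : ℝ) - 1)) atTop atTop)
    (t : ℝ) :
    Tendsto (fun n => ∫ S, cexp ((t * (((numAP (ℓ n) n S : ℝ)
        - ∫ S', (numAP (ℓ n) n S' : ℝ) ∂(randomSubset n (p n)))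
          / √(variance (fun S' => (numAP (ℓ n) n S' : ℝ)) (randomSubset n (p n)))) : ℝ) * I)
        ∂(randomSubset n (p n))) atTop (𝓝 (cexp (-(t ^ 2 / 2 : ℝ)))) := by
  have hμ := tendsto_card_mul_pow_atTop h3 hℓ h
  have ht := (tendsto_tripleSum_div h3 hℓ hp_pos hp h).const_mul (64 * |t| ^ 3)
  rw [mul_zero] at ht
  rw [tendsto_iff_norm_sub_tendsto_zero]
  refine squeeze_zero' (Eventually.of_forall fun n => norm_nonneg _) ?_ ht
  filter_upwards [h3, hp.eventually_lt_const (by norm_num : (0 : ℝ) < 1 / 2),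
    hμ.eventually_gt_atTop 0] with n hn hpn hμn
  have hV : 0 < varAP (ℓ n) n (p n) :=
    (half_pos hμn).trans_le (half_card_mul_pow_le_varAP (by omega) hpn.le)
  have hσ : √(varAP (ℓ n) n (p n)) ^ 2 = variance (fun S => ∑ a ∈ apSet (ℓ n) n, containsInd a S)
      (randomSubset n (p n)) := by
    rw [Real.sq_sqrt hV.le, varAP]
    simp only [numAP_cast]
  have := norm_integral_sub_gaussian_le (n := n) (p := p n) (F := apSet (ℓ n) n)
    (fun _ => subset_Icc_of_mem_apSet) (fun _ => card_of_mem_apSet) (Real.sqrt_pos.2 hV) hσ t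
  simp only [varAP, numAP_cast] at this ⊢
  rwa [integral_sum_containsInd (fun _ => subset_Icc_of_mem_apSet) (fun _ => card_of_mem_apSet)]

end NormalRegime

end RandomAP

theorem theorem1 (ℓ : ℕ → ℕ) (p : ℕ → unitInterval)
    (hℓ : (∃ ℓ₀ : ℕ, 3 ≤ ℓ₀ ∧ ∀ n, ℓ n = ℓ₀) ∨
      (Filter.Tendsto ℓ Filter.atTop Filter.atTop ∧
        Filter.Tendsto (fun n : ℕ => (ℓ n : ℝ) / Real.log (n : ℝ)) Filter.atTop (nhds 0)))
    (hp_pos : ∀ n, 0 < p n)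
    (hp : Filter.Tendsto (fun n : ℕ => (p n : ℝ)) Filter.atTop (nhds 0)) :
    (∀ c : NNReal,
      Filter.Tendsto (fun n : ℕ => (n : ℝ) ^ 2 * (p n : ℝ) ^ ℓ n / ((ℓ n : ℝ) - 1))
        Filter.atTop (nhds (c : ℝ)) →
      MeasureTheory.TendstoInDistribution (fun n : ℕ => RandomAP.numAP (ℓ n) n)
        Filter.atTop (id : ℕ → ℕ) (fun n : ℕ => RandomAP.randomSubset n (p n))
        (ProbabilityTheory.poissonMeasure (c / 2))) ∧
    (Filter.Tendsto (fun n : ℕ => (n : ℝ) ^ 2 * (p n : ℝ) ^ ℓ n / ((ℓ n : ℝ) - 1))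
        Filter.atTop Filter.atTop →
      MeasureTheory.TendstoInDistribution
        (fun (n : ℕ) (S : Set ℕ) =>
          ((RandomAP.numAP (ℓ n) n S : ℝ)
              - ∫ S', (RandomAP.numAP (ℓ n) n S' : ℝ) ∂(RandomAP.randomSubset n (p n)))
            / Real.sqrt (ProbabilityTheory.variance
                (fun S' : Set ℕ => (RandomAP.numAP (ℓ n) n S' : ℝ))
                (RandomAP.randomSubset n (p n))))
        Filter.atTop (id : ℝ → ℝ) (fun n : ℕ => RandomAP.randomSubset n (p n))
        (ProbabilityTheory.gaussianReal 0 1)) := by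
  have h3 : ∀ᶠ n in atTop, 3 ≤ ℓ n := by
    rcases hℓ with ⟨ℓ₀, h, hℓ⟩ | ⟨h, -⟩
    · exact Eventually.of_forall fun n => (hℓ n).symm ▸ h
    · exact h.eventually_ge_atTop 3
  -- A constant length is also `o(log n)`, so both alternatives merge.
  have hlog : Tendsto (fun n : ℕ => (ℓ n : ℝ) / Real.log (n : ℝ)) atTop (𝓝 0) := by
    rcases hℓ with ⟨ℓ₀, -, hℓ⟩ | ⟨-, h⟩
    · simp only [hℓ]
      exact (Real.tendsto_log_atTop.comp tendsto_natCast_atTop_atTop).const_div_atTop _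
    · exact h
  refine ⟨fun c hc => ?_, fun h => ?_⟩
  · refine RandomAP.tendstoInDistribution_poissonMeasure
      (fun n => (RandomAP.measurable_numAP _ _).aemeasurable) fun t => ?_
    simpa using RandomAP.tendsto_integral_numAP_poisson h3 hlog hp_pos hp c.2 hc t
  · exact RandomAP.tendstoInDistribution_gaussianReal
      (fun n => (RandomAP.integrable_randomSubset_real _).1.aemeasurable) fun t =>
      RandomAP.tendsto_integral_numAP_gaussian h3 hlog hp_pos hp h t
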